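/- Let $n\ge 1$ be an integer. **Nodes.** Let $X_n^*=\{2k:\ k\in\mathbb Z^3,\ -\tfrac n2\le k_1,k_2,k_3\le \tfrac n2\}\cup\{2k+1:\ k\in\mathbb Z^3,\ -\tfrac{n+1}2\le k_1,k_2,k_3\le\tfrac{n-1}2\}$ (where $2k+1=(2k_1+1,2k_2+1,2k_3+1)$) and $X_n^\circ=X_n^*\cap(-n,n)^3$. For $j\in X_n^*\setminus X_n^\circ$ let $\mathcal S_j=\{k\in X_n^*:\ \tfrac k{2n}-\tfrac j{2n}\in\mathbb Z^3\}$. **Homogeneous coordinates.** Points $x\in\mathbb R^3$ correspond to points $\mathbf t\in\mathbb R^4$ with $t_1+t_2+t_3+t_4=0$ by $x_1=t_2+t_3,\ x_2=t_1+t_3,\ x_3=t_1+t_2$, that is, $t_1=\tfrac12(-x_1+x_2+x_3)$, $t_2=\tfrac12(x_1-x_2+x_3)$, $t_3=\tfrac12(x_1+x_2-x_3)$, $t_4=-\tfrac12(x_1+x_2+x_3)$. Let $\Lambda_n^{\dagger*}=\{k\in\mathbb Z^3:\ -n\le k_\nu\pm k_\mu\le n,\ 1\le\nu<\mu\le3\}$,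 and let $\mathbb G_n$ be the set of $\mathbf j\in\mathbb Z^4$ with $j_1+j_2+j_3+j_4=0$, with all $j_\nu$ even and congruent to each other mod $4$, and with $|j_\nu-j_\mu|\le 4n$ for all $\nu,\mu$. The map $k\mapsto\mathbf j$, $j_1=2(-k_1+k_2+k_3)$, $j_2=2(k_1-k_2+k_3)$, $j_3=2(k_1+k_2-k_3)$, $j_4=-2(k_1+k_2+k_3)$, is a bijection of $\Lambda_n^{\dagger*}$ onto $\mathbb G_n$. Put $\mathrm e_k(x)=e^{2\pi i\,k\cdot x}$, $\mathrm e_{\mathbf j}(\mathbf t)=e^{\frac{\pi i}2\mathbf j\cdot\mathbf t}$, and for $m\ge 0$ $$D_m(x)=\sum_{k\in\Lambda_m^{\dagger*}}\mathrm e_k(x)=\sum_{\mathbf j\in\mathbb G_m}\mathrm e_{\mathbf j}(\mathbf t)=D_m^*(\mathbf t).$$ **Boundary weights and kernel.** For $\mathbf j\in\mathbb G_n$ let $\mu_{\mathbf j}^{(n)}=1$ if $|j_\nu-j_\mu|<4n$ for all $\nu,\mu$. Otherwise $\mathbf j/(4n)$ lies on the boundary of the closed rhombic dodecahedron $\{\mathbf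 t:\ \sum_i t_i=0,\ |t_i-t_l|\le1\}$, in the relative interior of exactly one face, edge or vertex $\{t_i-t_l=1\ \text{for all } i\in I,\ l\in J\}$ with disjoint nonempty $I,J\subset\{1,2,3,4\}$, and $\mu_{\mathbf j}^{(n)}=1/\binom{|I|+|J|}{|I|}$: the value is $\frac12$ for $(|I|,|J|)=(1,1)$; $\frac13$ for $(1,2),(2,1)$; $\frac14$ for $(1,3),(3,1)$; $\frac16$ for $(2,2)$. Let $$\Phi_n^*(x)=\frac1{2n^3}\sum_{k\in\Lambda_n^{\dagger*}}\widetilde\mu_k^{(n)}\mathrm e_k(x),\qquad \widetilde\Phi_n^*(\mathbf t)=\frac1{2n^3}\sum_{\mathbf j\in\mathbb G_n}\mu_{\mathbf j}^{(n)}\mathrm e_{\mathbf j}(\mathbf t),$$ where $\widetilde\mu_k^{(n)}=\mu_{\mathbf j}^{(n)}$ for the index $\mathbf j$ corresponding to $k$, and define $$I_n^*f(x)=\sum_{k\in X_n^*}f(\tfrac k{2n})\,\Phi_n^*(x-\tfrac k{2n}).$$ **Theorem.** (a) For every complex-valued function $f$ and every $j\in X_n^*$, $$I_n^*f(\tfrac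 j{2n})=\begin{cases} f(\tfrac j{2n}), & j\in X_n^\circ,\\[2pt] \displaystyle\sum_{k\in\mathcal S_j}f(\tfrac k{2n}), & j\in X_n^*\setminus X_n^\circ.\end{cases}$$ (b) $\Phi_n^*$ is real-valued, $\Phi_n^*(x)=\widetilde\Phi_n^*(\mathbf t)$ whenever $x$ and $\mathbf t$ correspond, and for every $\mathbf t$ with $t_1+t_2+t_3+t_4=0$ $$\widetilde\Phi_n^*(\mathbf t)=\frac1{2n^3}\Bigg[\frac12\big(D_n^*(\mathbf t)+D_{n-1}^*(\mathbf t)\big)-\frac13\sum_{\nu=1}^4\frac{\sin2\pi\lfloor\frac{n-1}2\rfloor t_\nu}{\sin2\pi t_\nu}\sum_{\substack{j=1\\ j\ne\nu}}^4\cos2\pi\big(nt_j+\lfloor\tfrac n2\rfloor t_\nu\big)-\frac13\sum_{1\le\mu<\nu\le4}\cos2\pi n(t_\mu+t_\nu)-\frac{\varepsilon_n}2\sum_{j=1}^4\cos2\pi nt_j\Bigg],$$ where $\varepsilon_n=1$ for $n$ even and $\varepsilon_n=0$ for $n$ odd, and where the quotients of sines are extended by continuity to the zeros of their denominators. (c)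 For every $x$ whose homogeneous coordinates satisfy $\sin 2\pi t_\nu\ne0$ for $\nu=1,\dots,4$, the value $\Phi_n^*(x)$ is given by the right-hand side of the formula in (b) with $\mathbf t$ expressed through $x$ and with $D_m^*(\mathbf t)$, $m=n$ and $m=n-1$, replaced by $$\widetilde\Theta_{m+1}(x)-\widetilde\Theta_m(x)-\big(\widetilde\Theta_m^{\mathrm{odd}}(x)-\widetilde\Theta_{m-2}^{\mathrm{odd}}(x)\big),$$ where $$\widetilde\Theta_m(x)=\frac{\sum_{i=1}^3\cos^2m\pi x_i-2\cos m\pi x_1\cos m\pi x_2\cos m\pi x_3-1}{\sum_{i=1}^3\cos^2\pi x_i-2\cos\pi x_1\cos\pi x_2\cos\pi x_3-1}$$ and, for integers $m$, $$\widetilde\Theta_m^{\mathrm{odd}}(x)=\sum_{j=1}^4\frac{\sin p\pi t_j}{\sin2\pi t_j}\prod_{i\ne j}\frac{\sin q\pi t_i}{\sin2\pi t_i},\qquad (p,q)=\begin{cases}(m,m+2),& m\text{ even},\\(m+3,m+1),& m\text{ odd}.\end{cases}$$ -/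

import Mathlib

open scoped Real

namespace RD

noncomputable section

/-- Componentwise parity description of the symmetric node set
`{2l : -n/2 ≤ l_i ≤ n/2} ∪ {2l+1 : -(n+1)/2 ≤ l_i ≤ (n-1)/2}` in `ℤ³`
(see `mem_nodes_iff`). -/
def nodes (n : ℕ) : Finset (Fin 3 → ℤ) :=
  (Finset.Icc (fun _ => -(n : ℤ)) (fun _ => (n : ℤ))).filter
    (fun k => (∀ i, Even (k i)) ∨ (∀ i, Odd (k i)))

theorem mem_nodes_iff (n : ℕ) (k : Fin 3 → ℤ) :
    k ∈ nodes n ↔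
      (∃ l : Fin 3 → ℤ, (∀ i, -(n : ℝ) / 2 ≤ l i ∧ (l i : ℝ) ≤ n / 2) ∧ ∀ i, k i = 2 * l i) ∨
      (∃ l : Fin 3 → ℤ, (∀ i, -((n : ℝ) + 1) / 2 ≤ l i ∧ (l i : ℝ) ≤ ((n : ℝ) - 1) / 2) ∧
        ∀ i, k i = 2 * l i + 1) := by
  simp only [nodes, Finset.mem_filter, Finset.mem_Icc, Pi.le_def]
  constructor
  · rintro ⟨⟨h1, h2⟩, h | h⟩
    · choose l hl using h
      refine Or.inl ⟨l, fun i => ?_, fun i => by rw [hl i]; ring⟩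
      have a1 : -(n : ℝ) ≤ (k i : ℝ) := by exact_mod_cast h1 i
      have a2 : (k i : ℝ) ≤ n := by exact_mod_cast h2 i
      have a3 : (k i : ℝ) = l i + l i := by exact_mod_cast hl i
      constructor <;> linarith
    · choose l hl using h
      refine Or.inr ⟨l, fun i => ?_, hl⟩
      have a1 : -(n : ℝ) ≤ (k i : ℝ) := by exact_mod_cast h1 i
      have a2 : (k i : ℝ) ≤ n := by exact_mod_cast h2 i
      have a3 : (k i : ℝ) = 2 * l i + 1 := by exact_mod_cast hl i
      constructor <;> linarith
  · rintro (⟨l, hl, hk⟩ | ⟨l, hl, hk⟩)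
    · have a3 : ∀ i, (k i : ℝ) = 2 * l i := fun i => by exact_mod_cast hk i
      refine ⟨⟨fun i => ?_, fun i => ?_⟩, Or.inl fun i => ⟨l i, by rw [hk i]; ring⟩⟩
      · have : -(n : ℝ) ≤ (k i : ℝ) := by linarith [(hl i).1, a3 i]
        exact_mod_cast this
      · have : (k i : ℝ) ≤ n := by linarith [(hl i).2, a3 i]
        exact_mod_cast this
    · have a3 : ∀ i, (k i : ℝ) = 2 * l i + 1 := fun i => by exact_mod_cast hk i
      refine ⟨⟨fun i => ?_, fun i => ?_⟩, Or.inr fun i => ⟨l i, hk i⟩⟩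
      · have : -(n : ℝ) ≤ (k i : ℝ) := by linarith [(hl i).1, a3 i]
        exact_mod_cast this
      · have : (k i : ℝ) ≤ n := by linarith [(hl i).2, a3 i]
        exact_mod_cast this

/-- The interior nodes: the nodes in the open cube `(-n, n)³`. -/
def interiorNodes (n : ℕ) : Finset (Fin 3 → ℤ) :=
  (nodes n).filter (fun k => ∀ i, -(n : ℤ) < k i ∧ k i < n)

/-- The point `k / (2n)` of `[-1/2, 1/2]³`. -/
def pt (n : ℕ) (k : Fin 3 → ℤ) : Fin 3 → ℝ := fun i => (k i : ℝ) / (2 * n)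

open Classical in
/-- The nodes `k` such that `k / (2n)` is congruent to `j / (2n)` modulo `ℤ³`. -/
def congrNodes (n : ℕ) (j : Fin 3 → ℤ) : Finset (Fin 3 → ℤ) :=
  (nodes n).filter (fun k => ∃ m : Fin 3 → ℤ, ∀ i, pt n k i - pt n j i = m i)

/-- The exponential `exp (2πi k·x)`. -/
def expo (k : Fin 3 → ℤ) (x : Fin 3 → ℝ) : ℂ :=
  Complex.exp (2 * π * Complex.I * ((∑ i, (k i : ℝ) * x i : ℝ) : ℂ))

/-- The integer points of the closed rhombic dodecahedron `-n ≤ x_ν ± x_μ ≤ n`, `ν < μ`.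
The ambient box is no restriction (see `mem_freqs_iff`). -/
def freqs (n : ℕ) : Finset (Fin 3 → ℤ) :=
  (Finset.Icc (fun _ => -(n : ℤ)) (fun _ => (n : ℤ))).filter
    (fun k => ∀ ν μ, ν < μ →
      (-(n : ℤ) ≤ k ν + k μ ∧ k ν + k μ ≤ n) ∧ (-(n : ℤ) ≤ k ν - k μ ∧ k ν - k μ ≤ n))

theorem mem_freqs_iff (n : ℕ) (k : Fin 3 → ℤ) :
    k ∈ freqs n ↔ ∀ ν μ, ν < μ →
      (-(n : ℤ) ≤ k ν + k μ ∧ k ν + k μ ≤ n) ∧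
        (-(n : ℤ) ≤ k ν - k μ ∧ k ν - k μ ≤ n) := by
  simp only [freqs, Finset.mem_filter, Finset.mem_Icc, Pi.le_def, and_iff_right_iff_imp]
  intro h
  have h1 := h 0 1 (by decide)
  have h2 := h 0 2 (by decide)
  constructor <;> intro i <;> fin_cases i <;> simp <;> omega

/-- From `x ∈ ℝ³` to homogeneous coordinates `t ∈ ℝ⁴`, `t₁ + t₂ + t₃ + t₄ = 0`. -/
def toHom (x : Fin 3 → ℝ) : Fin 4 → ℝ :=
  ![(-x 0 + x 1 + x 2) / 2, (x 0 - x 1 + x 2) / 2, (x 0 + x 1 - x 2) / 2,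
    (-x 0 - x 1 - x 2) / 2]

/-- From homogeneous coordinates back to `ℝ³`. -/
def ofHom (t : Fin 4 → ℝ) : Fin 3 → ℝ := ![t 1 + t 2, t 0 + t 2, t 1 + t 0]

/-- The index `𝐣` in homogeneous coordinates of `k ∈ ℤ³`. -/
def indexHom (k : Fin 3 → ℤ) : Fin 4 → ℤ :=
  ![2 * (-k 0 + k 1 + k 2), 2 * (k 0 - k 1 + k 2), 2 * (k 0 + k 1 - k 2),
    2 * (-k 0 - k 1 - k 2)]

/-- The integer points of the rhombic dodecahedron in homogeneous coordinates:
`j₁ + j₂ + j₃ + j₄ = 0`, all `j_ν` even and congruent mod 4, `|j_ν - j_μ| ≤ 4n`.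
The ambient box is no restriction (see `mem_freqsHom_iff`). -/
def freqsHom (n : ℕ) : Finset (Fin 4 → ℤ) :=
  (Finset.Icc (fun _ => -(4 * n : ℤ)) (fun _ => (4 * n : ℤ))).filter
    (fun j => ∑ i, j i = 0 ∧ (∀ ν μ, j ν ≡ j μ [ZMOD 4]) ∧ (∀ ν, j ν ≡ 0 [ZMOD 2]) ∧
      ∀ ν μ, -(4 * n : ℤ) ≤ j ν - j μ ∧ j ν - j μ ≤ 4 * n)

theorem mem_freqsHom_iff (n : ℕ) (j : Fin 4 → ℤ) :
    j ∈ freqsHom n ↔ ∑ i, j i = 0 ∧ (∀ ν μ, j ν ≡ j μ [ZMOD 4]) ∧ (∀ ν, j ν ≡ 0 [ZMOD 2]) ∧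
      ∀ ν μ, -(4 * n : ℤ) ≤ j ν - j μ ∧ j ν - j μ ≤ 4 * n := by
  simp only [freqsHom, Finset.mem_filter, Finset.mem_Icc, Pi.le_def, and_iff_right_iff_imp]
  rintro ⟨h0, -, -, h⟩
  rw [Fin.sum_univ_four] at h0
  constructor <;> intro i <;> have a0 := h i 0 <;> have a1 := h i 1 <;> have a2 := h i 2 <;>
    have a3 := h i 3 <;> omega

/-- The exponential `exp ((πi/2) 𝐣·𝐭)`. -/
def expoHom (j : Fin 4 → ℤ) (t : Fin 4 → ℝ) : ℂ :=
  Complex.exp (π * Complex.I / 2 * ((∑ i, (j i : ℝ) * t i : ℝ) : ℂ))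

/-- The partial sum `D_n^*(𝐭)` over the rhombic dodecahedron. -/
def partialSum (n : ℕ) (t : Fin 4 → ℝ) : ℂ := ∑ j ∈ freqsHom n, expoHom j t

/-- The intersection of the closed faces `t_i - t_j = 1` (`i ∈ I`, `j ∈ J`) of the closed
rhombic dodecahedron `t₁ + t₂ + t₃ + t₄ = 0`, `|t_i - t_j| ≤ 1`. -/
def faceInter (I J : Finset (Fin 4)) : Set (Fin 4 → ℝ) :=
  {t | ∑ i, t i = 0 ∧ (∀ i j, |t i - t j| ≤ 1) ∧ ∀ i ∈ I, ∀ j ∈ J, t i - t j = 1}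

/-- Pairs of disjoint nonempty subsets of the index set. -/
def IsPair (I J : Finset (Fin 4)) : Prop := I.Nonempty ∧ J.Nonempty ∧ Disjoint I J

/-- The relatively open boundary element (face, edge or vertex, for
`|I| + |J| = 2, 3, 4`) indexed by `(I, J)`. -/
def boundaryElt (I J : Finset (Fin 4)) : Set (Fin 4 → ℝ) :=
  {t | t ∈ faceInter I J ∧
    ∀ I₁ J₁, IsPair I₁ J₁ → I.card + J.card < I₁.card + J₁.card → t ∉ faceInter I₁ J₁}

/-- The union of all boundary elements of type `(a, b)`. Since the boundary elements congruent
to the one indexed by `(I, J)` are obtained by permuting the indices in `I ∪ J`, this is also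
the union of the congruence classes of the boundary elements with `|I| = a`, `|J| = b`. -/
def boundaryType (a b : ℕ) : Set (Fin 4 → ℝ) :=
  {t | ∃ I J, IsPair I J ∧ I.card = a ∧ J.card = b ∧ t ∈ boundaryElt I J}

/-- The frequencies `𝐣` with `𝐣 / (4n)` on a boundary element of type `(a, b)`. -/
def freqsType (n a b : ℕ) : Set (Fin 4 → ℤ) :=
  {j | j ∈ freqsHom n ∧ (fun i => (j i : ℝ) / (4 * n)) ∈ boundaryType a b}

/-- The frequencies in the open rhombic dodecahedron. -/
def freqsInt (n : ℕ) : Set (Fin 4 → ℤ) :=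
  {j | j ∈ freqsHom n ∧ ∀ ν μ, -(4 * n : ℤ) < j ν - j μ ∧ j ν - j μ < 4 * n}

open Classical in
/-- The boundary weights; they are only used on `freqsHom n`. -/
def weight (n : ℕ) (j : Fin 4 → ℤ) : ℝ :=
  if j ∈ freqsInt n then 1
  else if j ∈ freqsType n 1 1 then 1 / 2
  else if j ∈ freqsType n 1 2 ∪ freqsType n 2 1 then 1 / 3
  else if j ∈ freqsType n 1 3 ∪ freqsType n 3 1 then 1 / 4
  else if j ∈ freqsType n 2 2 then 1 / 6
  else 0

/-- The boundary-weighted kernel `Φ_n^*`. -/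
def kernel (n : ℕ) (x : Fin 3 → ℝ) : ℂ :=
  1 / (2 * (n : ℂ) ^ 3) * ∑ k ∈ freqs n, (weight n (indexHom k) : ℂ) * expo k x

/-- The kernel in homogeneous coordinates. -/
def kernelHom (n : ℕ) (t : Fin 4 → ℝ) : ℂ :=
  1 / (2 * (n : ℂ) ^ 3) * ∑ j ∈ freqsHom n, (weight n j : ℂ) * expoHom j t

/-- The operator `I_n^*`. -/
def interp (n : ℕ) (f : (Fin 3 → ℝ) → ℂ) (x : Fin 3 → ℝ) : ℂ :=
  ∑ k ∈ nodes n, f (pt n k) * kernel n (x - pt n k)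

/-- The quotient `sin (m s) / sin s`, extended continuously to the zeros of `sin`
(see `continuous_sinQuot`). -/
def sinQuot (m : ℕ) (s : ℝ) : ℝ :=
  if Real.sin s = 0 then m * Real.cos (m * s) / Real.cos s else Real.sin (m * s) / Real.sin s

theorem sinQuot_succ (m : ℕ) (s : ℝ) :
    sinQuot (m + 1) s = sinQuot m s * Real.cos s + Real.cos (m * s) := by
  have h1 : ((m + 1 : ℕ) : ℝ) * s = m * s + s := by push_cast; ring
  unfold sinQuot
  rw [h1]
  split_ifs with h
  · have hc : Real.cos s ≠ 0 := by
      intro hc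
      have := Real.sin_sq_add_cos_sq s
      rw [h, hc] at this
      norm_num at this
    rw [Real.cos_add, h]
    push_cast
    field_simp
    ring
  · rw [Real.sin_add]
    field_simp

theorem continuous_sinQuot (m : ℕ) : Continuous (sinQuot m) := by
  induction m with
  | zero =>
    have : sinQuot 0 = fun _ => 0 := by funext s; simp [sinQuot]
    rw [this]; exact continuous_const
  | succ m ih =>
    have : sinQuot (m + 1) = fun s => sinQuot m s * Real.cos s + Real.cos (m * s) := by
      funext s; exact sinQuot_succ m s
    rw [this]; fun_prop

/-- `Θ̃_n(x)`. -/
def theta (n : ℤ) (x : Fin 3 → ℝ) : ℝ :=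
  (Real.cos (n * π * x 0) ^ 2 + Real.cos (n * π * x 1) ^ 2 + Real.cos (n * π * x 2) ^ 2
      - 2 * Real.cos (n * π * x 0) * Real.cos (n * π * x 1) * Real.cos (n * π * x 2) - 1) /
    (Real.cos (π * x 0) ^ 2 + Real.cos (π * x 1) ^ 2 + Real.cos (π * x 2) ^ 2
      - 2 * Real.cos (π * x 0) * Real.cos (π * x 1) * Real.cos (π * x 2) - 1)

/-- `Θ̃_n^odd(x)`, the product `∏ᵢ sin((n+2)πtᵢ)/sin(2πtᵢ) · ∑ⱼ sin(nπtⱼ)/sin((n+2)πtⱼ)` for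
even `n` and `∏ᵢ sin((n+1)πtᵢ)/sin(2πtᵢ) · ∑ⱼ sin((n+3)πtⱼ)/sin((n+1)πtⱼ)` for odd `n`,
written with the `j`-th factor cancelled, where `t` are the homogeneous coordinates of `x`. -/
def thetaOdd (n : ℤ) (x : Fin 3 → ℝ) : ℝ :=
  if Even n then
    ∑ j, Real.sin (n * π * toHom x j) / Real.sin (2 * π * toHom x j) *
      ∏ i ∈ Finset.univ.erase j,
        Real.sin ((n + 2) * π * toHom x i) / Real.sin (2 * π * toHom x i)
  else
    ∑ j, Real.sin ((n + 3) * π * toHom x j) / Real.sin (2 * π * toHom x j) *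
      ∏ i ∈ Finset.univ.erase j,
        Real.sin ((n + 1) * π * toHom x i) / Real.sin (2 * π * toHom x i)

/-- The closed form of the partial sum `D_n(x)` at points where no denominator vanishes. -/
def partialSumClosed (n : ℤ) (x : Fin 3 → ℝ) : ℝ :=
  theta (n + 1) x - theta n x - (thetaOdd n x - thetaOdd (n - 2) x)

/-- The correction terms with value `-½ ∑ⱼ cos(2πn tⱼ)` for even `n` (vertices of type `(1,3)`
and `(3,1)`) and `-⅓ ∑_{μ<ν} cos(2πn(t_μ+t_ν))` (vertices of type `(2,2)`). -/
def vertexCorrection (n : ℕ) (t : Fin 4 → ℝ) : ℝ :=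
  - (1 / 3) * (∑ ν : Fin 4, ∑ μ ∈ Finset.univ.filter (fun μ => μ < ν),
      Real.cos (2 * π * n * (t μ + t ν)))
    - 1 / 2 * (if Even n then ∑ j, Real.cos (2 * π * n * t j) else 0)

end

end RD

/-! Interpolation. Over the frequencies in the dodecahedron, the pairs of indices with maximal
difference `4n` form a product `topSet × botSet`, and the weight is the reciprocal of a binomial
coefficient in the two cardinalities. That reciprocal is the probability that a random order of the
four indices puts all of `topSet` below all of `botSet`. Hence the weight is the average, over the
24 permutations `s`, of the indicator of a half-open tile (`weight_eq_average`). Each tile contains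
exactly one representative of every class modulo `n` times the face-centred cubic lattice
(`exists_mem_tile`, `tile_unique`), and so does a rectangular box with `2n³` points. At a difference
of two nodes of equal or opposite parity the exponentials depend only on the class, so every tile
may be replaced by the box. There the sum factors into geometric sums, and the kernel becomes the
indicator of congruence modulo `2n` (`kernel_pt`).

Compact formula. Half of `D_n^* + D_{n-1}^*` gives weight 1 inside and `1/2` on the whole boundary,
which is right on open faces. On edges and vertices the excess is a combination of indicators of
boundary elements (`choose_inv_eq`). The frequencies on an edge form an arithmetic progression,
summed by `sum_range_cos`; a vertex carries at most one.

Closed form of the partial sums. With `z_i = exp (2πi t_i)` the product of the `z_i` is 1, and `𝐣 =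
4p - ∑ p` identifies the frequencies with exponent vectors `p` of even total degree, entries at most
`n` and minimum 0. Dividing out `z₁z₂z₃z₄` shows that their sum is the increment from `n` to `n + 1`
of the even part of `∏ (1 + z_i + ⋯ + z_i^(N-1))` (`partialSum_eq_evenSum`). The full product is
`theta` (`prod_sum_range_eq_theta`), and the increment of its odd part is a difference of two
`thetaOdd` (`oddPart_sub`). -/

namespace RD

/-! ### Boundary elements through extremal indices -/

/-- The indices `i` for which `j i - j l = 4n` for some `l`. -/
def topSet (n : ℕ) (j : Fin 4 → ℤ) : Finset (Fin 4) :=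
  Finset.univ.filter (fun i => ∃ l, j i - j l = 4 * n)

/-- The indices `l` for which `j i - j l = 4n` for some `i`. -/
def botSet (n : ℕ) (j : Fin 4 → ℤ) : Finset (Fin 4) :=
  Finset.univ.filter (fun l => ∃ i, j i - j l = 4 * n)

theorem mem_topSet {n : ℕ} {j : Fin 4 → ℤ} {i : Fin 4} :
    i ∈ topSet n j ↔ ∃ l, j i - j l = 4 * n := by simp [topSet]

theorem mem_botSet {n : ℕ} {j : Fin 4 → ℤ} {l : Fin 4} :
    l ∈ botSet n j ↔ ∃ i, j i - j l = 4 * n := by simp [botSet]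

theorem sub_le_of_mem_freqsHom {n : ℕ} {j : Fin 4 → ℤ} (hj : j ∈ freqsHom n) (i l : Fin 4) :
    j i - j l ≤ 4 * n := (((mem_freqsHom_iff n j).1 hj).2.2.2 i l).2

/-- If `j i - j l'` and `j i' - j l` are both maximal, then `j i - j l` and `j i' - j l'` have the
same total `8n`; neither exceeds `4n`, so both equal it. -/
theorem sub_eq_iff {n : ℕ} {j : Fin 4 → ℤ} (hj : j ∈ freqsHom n) (i l : Fin 4) :
    j i - j l = 4 * n ↔ i ∈ topSet n j ∧ l ∈ botSet n j := by
  constructor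
  · intro h
    exact ⟨mem_topSet.2 ⟨l, h⟩, mem_botSet.2 ⟨i, h⟩⟩
  · rintro ⟨h1, h2⟩
    obtain ⟨l', h1⟩ := mem_topSet.1 h1
    obtain ⟨i', h2⟩ := mem_botSet.1 h2
    have h3 := sub_le_of_mem_freqsHom hj i l
    have h4 := sub_le_of_mem_freqsHom hj i' l'
    omega

theorem disjoint_topSet_botSet {n : ℕ} (hn : 1 ≤ n) {j : Fin 4 → ℤ} (hj : j ∈ freqsHom n) :
    Disjoint (topSet n j) (botSet n j) := by
  rw [Finset.disjoint_left]
  intro i h1 h2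
  have := (sub_eq_iff hj i i).2 ⟨h1, h2⟩
  omega

theorem topSet_nonempty_iff {n : ℕ} {j : Fin 4 → ℤ} :
    (topSet n j).Nonempty ↔ (botSet n j).Nonempty := by
  constructor
  · rintro ⟨i, hi⟩
    obtain ⟨l, h⟩ := mem_topSet.1 hi
    exact ⟨l, mem_botSet.2 ⟨i, h⟩⟩
  · rintro ⟨l, hl⟩
    obtain ⟨i, h⟩ := mem_botSet.1 hl
    exact ⟨i, mem_topSet.2 ⟨l, h⟩⟩

theorem div_mem_faceInter_iff {n : ℕ} (hn : 1 ≤ n) {j : Fin 4 → ℤ} (hj : j ∈ freqsHom n)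
    {I J : Finset (Fin 4)} (h : IsPair I J) :
    (fun i => (j i : ℝ) / (4 * n)) ∈ faceInter I J ↔ I ⊆ topSet n j ∧ J ⊆ botSet n j := by
  have hn' : (0 : ℝ) < 4 * n := by positivity
  have key : ∀ i l, (j i : ℝ) / (4 * n) - (j l : ℝ) / (4 * n) = 1 ↔ j i - j l = 4 * n := by
    intro i l
    rw [← sub_div, div_eq_one_iff_eq hn'.ne']
    exact_mod_cast Iff.rfl
  have hsum : ∑ i, (j i : ℝ) / (4 * n) = 0 := by
    rw [← Finset.sum_div]
    have : (∑ i, (j i : ℝ)) = 0 := by exact_mod_cast ((mem_freqsHom_iff n j).1 hj).1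
    rw [this, zero_div]
  have habs : ∀ i l, |(j i : ℝ) / (4 * n) - (j l : ℝ) / (4 * n)| ≤ 1 := by
    intro i l
    rw [← sub_div, abs_div, abs_of_pos hn', div_le_one hn', abs_le]
    have h1 := sub_le_of_mem_freqsHom hj i l
    have h2 := sub_le_of_mem_freqsHom hj l i
    have h3 : -(4 * n : ℤ) ≤ j i - j l := by omega
    exact ⟨by exact_mod_cast h3, by exact_mod_cast h1⟩
  simp only [faceInter, Set.mem_ofPred_eq]
  obtain ⟨⟨i₀, hi₀⟩, ⟨l₀, hl₀⟩, -⟩ := h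
  constructor
  · rintro ⟨-, -, h⟩
    refine ⟨fun i hi => ?_, fun l hl => ?_⟩
    · exact ((sub_eq_iff hj i l₀).1 ((key _ _).1 (h i hi l₀ hl₀))).1
    · exact ((sub_eq_iff hj i₀ l).1 ((key _ _).1 (h i₀ hi₀ l hl))).2
  · rintro ⟨h1, h2⟩
    exact ⟨hsum, habs, fun i hi l hl => (key _ _).2 ((sub_eq_iff hj i l).2 ⟨h1 hi, h2 hl⟩)⟩

/-- Every pair whose face intersection contains the point is contained in `(topSet, botSet)`, which
is itself such a pair; maximality of the total cardinality therefore singles it out. -/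
theorem mem_freqsType_iff {n : ℕ} (hn : 1 ≤ n) {j : Fin 4 → ℤ} (hj : j ∈ freqsHom n) (a b : ℕ) :
    j ∈ freqsType n a b ↔
      (topSet n j).Nonempty ∧ (topSet n j).card = a ∧ (botSet n j).card = b := by
  simp only [freqsType, boundaryType, boundaryElt, Set.mem_ofPred_eq, hj, true_and]
  constructor
  · rintro ⟨I, J, hp, rfl, rfl, hf, hmax⟩
    rw [div_mem_faceInter_iff hn hj hp] at hf
    have hne : (topSet n j).Nonempty := hp.1.mono hf.1
    have hp' : IsPair (topSet n j) (botSet n j) :=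
      ⟨hne, topSet_nonempty_iff.1 hne, disjoint_topSet_botSet hn hj⟩
    have h1 := hmax _ _ hp'
    rw [div_mem_faceInter_iff hn hj hp'] at h1
    have h2 := Finset.card_le_card hf.1
    have h3 := Finset.card_le_card hf.2
    have h4 : ¬ (I.card + J.card < (topSet n j).card + (botSet n j).card) :=
      fun h => h1 h ⟨Finset.Subset.refl _, Finset.Subset.refl _⟩
    exact ⟨hne, by omega, by omega⟩
  · rintro ⟨hne, rfl, rfl⟩
    have hp' : IsPair (topSet n j) (botSet n j) :=
      ⟨hne, topSet_nonempty_iff.1 hne, disjoint_topSet_botSet hn hj⟩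
    refine ⟨_, _, hp', rfl, rfl,
      (div_mem_faceInter_iff hn hj hp').2 ⟨Finset.Subset.refl _, Finset.Subset.refl _⟩, ?_⟩
    intro I J hp hlt hf
    rw [div_mem_faceInter_iff hn hj hp] at hf
    have h2 := Finset.card_le_card hf.1
    have h3 := Finset.card_le_card hf.2
    omega

theorem mem_freqsInt_iff {n : ℕ} {j : Fin 4 → ℤ} (hj : j ∈ freqsHom n) :
    j ∈ freqsInt n ↔ topSet n j = ∅ := by
  simp only [freqsInt, Set.mem_ofPred_eq, hj, true_and, Finset.eq_empty_iff_forall_notMem,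
    mem_topSet, not_exists]
  constructor
  · intro h i l
    have := h i l
    omega
  · intro h i l
    have h1 := h i l
    have h2 := h l i
    have h3 := sub_le_of_mem_freqsHom hj i l
    have h4 := sub_le_of_mem_freqsHom hj l i
    omega

theorem weight_eq {n : ℕ} (hn : 1 ≤ n) {j : Fin 4 → ℤ} (hj : j ∈ freqsHom n) :
    weight n j = 1 / (((topSet n j).card + (botSet n j).card).choose (topSet n j).card : ℝ) := by
  unfold weight
  simp only [mem_freqsInt_iff hj, Set.mem_union, mem_freqsType_iff hn hj]
  rcases (topSet n j).eq_empty_or_nonempty with h | h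
  · have h' : botSet n j = ∅ := by
      rw [← Finset.not_nonempty_iff_eq_empty, ← topSet_nonempty_iff, h]; simp
    simp [h, h']
  · have h' := topSet_nonempty_iff.1 h
    have h1 := h.card_pos
    have h2 := h'.card_pos
    have h3 : (topSet n j).card + (botSet n j).card ≤ 4 := by
      rw [← Finset.card_union_of_disjoint (disjoint_topSet_botSet hn hj)]
      exact (Finset.card_le_univ _).trans (by simp)
    simp only [h.ne_empty, h, if_false, true_and]
    generalize (topSet n j).card = a at *
    generalize (botSet n j).card = b at *
    have ha : a ≤ 3 := by omega
    have hb : b ≤ 3 := by omega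
    interval_cases a <;> interval_cases b <;> first | omega | norm_num [Nat.choose]

/-! ### Weights as averages over permutations -/

/-- A permutation orders `I ∪ J` uniformly, and exactly one of the possible choices of `I.card`
positions for `I` is the lowest one. -/
theorem card_perm_lt (I J : Finset (Fin 4)) (h : Disjoint I J) :
    (Finset.univ.filter (fun s : Equiv.Perm (Fin 4) => ∀ i ∈ I, ∀ l ∈ J, s i < s l)).card *
      (I.card + J.card).choose I.card = 24 := by
  revert I J
  decide +kernel

/-- The tile attached to `s`: frequencies whose maximal differences are increasing for `s`. -/
def InTile (n : ℕ) (s : Equiv.Perm (Fin 4)) (j : Fin 4 → ℤ) : Prop :=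
  ∀ i l, j i - j l ≤ 4 * n ∧ (j i - j l = 4 * n → s i < s l)

instance (n : ℕ) (s : Equiv.Perm (Fin 4)) (j : Fin 4 → ℤ) : Decidable (InTile n s j) := by
  unfold InTile; infer_instance

theorem weight_eq_average {n : ℕ} (hn : 1 ≤ n) {j : Fin 4 → ℤ} (hj : j ∈ freqsHom n) :
    weight n j = 1 / 24 * ∑ s : Equiv.Perm (Fin 4), if InTile n s j then (1 : ℝ) else 0 := by
  have h := card_perm_lt _ _ (disjoint_topSet_botSet hn hj)
  have h2 : ∀ s : Equiv.Perm (Fin 4), InTile n s j ↔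
      ∀ i ∈ topSet n j, ∀ l ∈ botSet n j, s i < s l := by
    intro s
    constructor
    · intro h i hi l hl
      exact (h i l).2 ((sub_eq_iff hj i l).2 ⟨hi, hl⟩)
    · intro h i l
      refine ⟨sub_le_of_mem_freqsHom hj i l, fun he => ?_⟩
      have := (sub_eq_iff hj i l).1 he
      exact h i this.1 l this.2
  rw [weight_eq hn hj, Finset.sum_boole]
  simp only [h2]
  have h3 := congrArg (Nat.cast : ℕ → ℝ) h
  push_cast at h3
  have h4 : (((topSet n j).card + (botSet n j).card).choose (topSet n j).card : ℝ) ≠ 0 := by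
    intro h0
    rw [h0] at h3
    norm_num at h3
  field_simp
  linarith

/-! ### Transversals of the scaled face-centred cubic lattice -/

theorem sum_eq_sum_of_transversal {α β : Type*} [AddCommMonoid β] (R : α → α → Prop)
    (htrans : ∀ x y z, R x y → R y z → R x z) (A B : Finset α)
    (hA : ∀ x, ∃ y ∈ A, R x y) (hB : ∀ x, ∃ y ∈ B, R x y)
    (uA : ∀ x ∈ A, ∀ y ∈ A, R x y → x = y) (uB : ∀ x ∈ B, ∀ y ∈ B, R x y → x = y)
    (f : α → β) (hf : ∀ x y, R x y → f x = f y) : ∑ x ∈ A, f x = ∑ x ∈ B, f x := by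
  choose a ha using hA
  choose b hb using hB
  refine Finset.sum_bij' (fun x _ => b x) (fun x _ => a x) (fun x _ => (hb x).1)
    (fun x _ => (ha x).1) (fun x hx => ?_) (fun x hx => ?_) (fun x _ => hf _ _ (hb x).2)
  · exact (uA _ hx _ (ha _).1 (htrans _ _ _ (hb x).2 (ha _).2)).symm
  · exact (uB _ hx _ (hb _).1 (htrans _ _ _ (ha x).2 (hb _).2)).symm

/-- Congruence modulo `n` times the face-centred cubic lattice. -/
def FccCongr (n : ℕ) (k k' : Fin 3 → ℤ) : Prop :=
  ∃ a : Fin 3 → ℤ, Even (a 0 + a 1 + a 2) ∧ ∀ i, k' i = k i + n * a i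

theorem FccCongr.symm {n : ℕ} {k k' : Fin 3 → ℤ} (h : FccCongr n k k') : FccCongr n k' k := by
  obtain ⟨a, ha, h⟩ := h
  refine ⟨-a, ?_, fun i => ?_⟩
  · obtain ⟨c, hc⟩ := ha
    exact ⟨-c, by simp only [Pi.neg_apply]; omega⟩
  · rw [h i]; simp

theorem FccCongr.trans {n : ℕ} {k k' k'' : Fin 3 → ℤ} (h : FccCongr n k k')
    (h' : FccCongr n k' k'') : FccCongr n k k'' := by
  obtain ⟨a, ha, h⟩ := h
  obtain ⟨b, hb, h'⟩ := h'
  refine ⟨a + b, ?_, fun i => ?_⟩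
  · obtain ⟨c, hc⟩ := ha
    obtain ⟨c', hc'⟩ := hb
    exact ⟨c + c', by simp only [Pi.add_apply]; omega⟩
  · rw [h' i, h i]; simp; ring

/-- Descent on the squared length of the perturbed vector `5 * j + s`. Values of `s` differ by at
most 3, less than 5, so the perturbation only breaks ties: a violation of `InTile` is a perturbed
difference larger than `20n`. -/
theorem exists_inTile (n : ℕ) (hn : 1 ≤ n) (s : Equiv.Perm (Fin 4)) (j : Fin 4 → ℤ) :
    ∃ m : Fin 4 → ℤ, ∑ i, m i = 0 ∧ InTile n s (fun i => j i + 4 * n * m i) := by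
  generalize hN : (∑ i, (5 * j i + (s i : ℤ)) ^ 2).toNat = N
  induction N using Nat.strong_induction_on generalizing j with
  | _ N ih =>
  by_cases h : InTile n s j
  · exact ⟨0, by simp, by simpa using h⟩
  have : ∃ i l, i ≠ l ∧ 5 * (4 * n : ℤ) < (5 * j i + (s i : ℤ)) - (5 * j l + (s l : ℤ)) := by
    unfold InTile at h
    push Not at h
    obtain ⟨i, l, h⟩ := h
    have hsi := (s i).isLt
    have hsl := (s l).isLt
    by_cases h1 : j i - j l ≤ 4 * n
    · obtain ⟨h2, h3⟩ := h h1
      have hil : i ≠ l := by rintro rfl; omega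
      have h4 : s l ≠ s i := fun e => hil (s.injective e).symm
      have h5 : s l < s i := lt_of_le_of_ne h3 h4
      have h6 : (s l : ℕ) < s i := h5
      exact ⟨i, l, hil, by omega⟩
    · refine ⟨i, l, ?_, by omega⟩
      rintro rfl
      omega
  obtain ⟨i, l, hil, hlt⟩ := this
  -- Moving `4n` from coordinate `i` to coordinate `l` lowers the squared length by `40n` times the
  -- excess of the perturbed difference over `20n`.
  set e : Fin 4 → ℤ := fun x => (if x = i then -1 else 0) + (if x = l then 1 else 0) with he
  have hesum : ∑ x, e x = 0 := by simp [he, Finset.sum_add_distrib]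
  have hdec : ∑ x, (5 * (j x + 4 * n * e x) + (s x : ℤ)) ^ 2 <
      ∑ x, (5 * j x + (s x : ℤ)) ^ 2 := by
    have h1 : ∀ x, (5 * (j x + 4 * n * e x) + (s x : ℤ)) ^ 2 = (5 * j x + (s x : ℤ)) ^ 2 +
        ((if x = i then (20 * n) ^ 2 - 40 * n * (5 * j x + (s x : ℤ)) else 0) +
        (if x = l then (20 * n) ^ 2 + 40 * n * (5 * j x + (s x : ℤ)) else 0)) := by
      intro x
      by_cases hxi : x = i
      · have hxl : x ≠ l := fun h => hil (hxi ▸ h)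
        simp [he, hxi, hil]; ring
      · by_cases hxl : x = l
        · simp [he, hxl, hil.symm]; ring
        · simp [he, hxi, hxl]
    simp only [h1, Finset.sum_add_distrib, Finset.sum_ite_eq', Finset.mem_univ, if_true]
    have hn' : (0 : ℤ) < 40 * n := by positivity
    nlinarith [mul_lt_mul_of_pos_left hlt hn']
  have hnn : 0 ≤ ∑ x, (5 * (j x + 4 * n * e x) + (s x : ℤ)) ^ 2 :=
    Finset.sum_nonneg fun _ _ => sq_nonneg _
  obtain ⟨m, hm, ht⟩ := ih (∑ x, (5 * (j x + 4 * n * e x) + (s x : ℤ)) ^ 2).toNat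
    (by omega) (fun x => j x + 4 * n * e x) rfl
  refine ⟨fun x => e x + m x, by rw [Finset.sum_add_distrib, hesum, hm, add_zero], ?_⟩
  convert ht using 2
  ring

/-- A gap of 2 in `m` would carry a difference from `-4n` to `4n` exactly, and the two tie-breaking
conditions would contradict each other. So the entries of `m` spread by at most 1, and four such
integers with sum 0 all vanish. -/
theorem inTile_unique {n : ℕ} (hn : 1 ≤ n) {s : Equiv.Perm (Fin 4)} {j m : Fin 4 → ℤ}
    (hm : ∑ i, m i = 0) (h : InTile n s j) (h' : InTile n s (fun i => j i + 4 * n * m i)) :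
    m = 0 := by
  have key : ∀ i l, m i - m l ≤ 1 := by
    intro i l
    by_contra hc
    have hc : 2 ≤ m i - m l := by omega
    have h1 := h l i
    have h2 := h' i l
    have h3 : (4 * n : ℤ) * 2 ≤ 4 * n * (m i - m l) :=
      mul_le_mul_of_nonneg_left hc (by positivity)
    simp only at h2
    have h4 : j i + 4 * n * m i - (j l + 4 * n * m l) = (j i - j l) + 4 * n * (m i - m l) := by
      ring
    rw [h4] at h2
    have h5 := h1.2 (by omega)
    have h6 := h2.2 (by omega)
    exact absurd h5 h6.asymm
  rw [Fin.sum_univ_four] at hm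
  have := key 0 1
  have := key 0 2
  have := key 0 3
  have := key 1 0
  have := key 1 2
  have := key 1 3
  have := key 2 0
  have := key 2 1
  have := key 2 3
  have := key 3 0
  have := key 3 1
  have := key 3 2
  funext i
  fin_cases i <;> simp <;> omega

theorem indexHom_mem_freqsHom_iff {n : ℕ} {k : Fin 3 → ℤ} :
    indexHom k ∈ freqsHom n ↔ k ∈ freqs n := by
  rw [mem_freqsHom_iff, mem_freqs_iff]
  constructor
  · rintro ⟨-, -, -, h⟩ ν μ hlt
    have h01 := h 0 1
    have h02 := h 0 2
    have h03 := h 0 3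
    have h12 := h 1 2
    have h13 := h 1 3
    have h23 := h 2 3
    simp [indexHom] at h01 h02 h03 h12 h13 h23
    fin_cases ν <;> fin_cases μ <;> simp at hlt ⊢ <;> omega
  · intro h
    have h01 := h 0 1 (by decide)
    have h02 := h 0 2 (by decide)
    have h12 := h 1 2 (by decide)
    refine ⟨?_, ?_, ?_, ?_⟩
    · simp [Fin.sum_univ_four, indexHom]; ring
    · intro ν μ
      fin_cases ν <;> fin_cases μ <;> simp [indexHom, Int.ModEq] <;> omega
    · intro ν
      fin_cases ν <;> simp [indexHom, Int.ModEq]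
    · intro ν μ
      fin_cases ν <;> fin_cases μ <;> simp [indexHom] <;> omega

theorem indexHom_injective : Function.Injective indexHom := by
  intro k k' h
  have h0 := congrFun h 0
  have h1 := congrFun h 1
  have h2 := congrFun h 2
  simp [indexHom] at h0 h1 h2
  funext i
  fin_cases i <;> simp <;> omega

theorem exists_indexHom_eq {n : ℕ} {j : Fin 4 → ℤ} (hj : j ∈ freqsHom n) :
    ∃ k, indexHom k = j := by
  obtain ⟨h0, h4, h2, -⟩ := (mem_freqsHom_iff n j).1 hj
  rw [Fin.sum_univ_four] at h0
  have a := h4 0 1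
  have b := h4 0 2
  have c := h2 0
  simp only [Int.ModEq] at a b c
  -- The divisions are exact: two even numbers congruent mod 4 have a sum divisible by 4.
  refine ⟨![(j 1 + j 2) / 4, (j 0 + j 2) / 4, (j 0 + j 1) / 4], ?_⟩
  funext i
  fin_cases i <;> simp [indexHom] <;> omega

theorem sum_freqsHom {β : Type*} [AddCommMonoid β] (n : ℕ) (f : (Fin 4 → ℤ) → β) :
    ∑ j ∈ freqsHom n, f j = ∑ k ∈ freqs n, f (indexHom k) := by
  symm
  refine Finset.sum_bij (fun k _ => indexHom k) (fun k hk => indexHom_mem_freqsHom_iff.2 hk)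
    (fun k _ k' _ h => indexHom_injective h) (fun j hj => ?_) (fun _ _ => rfl)
  obtain ⟨k, rfl⟩ := exists_indexHom_eq hj
  exact ⟨k, indexHom_mem_freqsHom_iff.1 hj, rfl⟩

theorem InTile.mem_freqs {n : ℕ} {s : Equiv.Perm (Fin 4)} {k : Fin 3 → ℤ}
    (h : InTile n s (indexHom k)) : k ∈ freqs n := by
  rw [mem_freqs_iff]
  intro ν μ hlt
  have h01 := (h 0 1).1
  have h02 := (h 0 2).1
  have h03 := (h 0 3).1
  have h12 := (h 1 2).1
  have h13 := (h 1 3).1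
  have h23 := (h 2 3).1
  have h10 := (h 1 0).1
  have h20 := (h 2 0).1
  have h30 := (h 3 0).1
  have h21 := (h 2 1).1
  have h31 := (h 3 1).1
  have h32 := (h 3 2).1
  simp [indexHom] at h01 h02 h03 h12 h13 h23 h10 h20 h30 h21 h31 h32
  fin_cases ν <;> fin_cases μ <;> simp at hlt ⊢ <;> omega

/-- The half-open tile attached to `s`. -/
noncomputable def tile (n : ℕ) (s : Equiv.Perm (Fin 4)) : Finset (Fin 3 → ℤ) :=
  (freqs n).filter fun k => InTile n s (indexHom k)

theorem mem_tile {n : ℕ} {s : Equiv.Perm (Fin 4)} {k : Fin 3 → ℤ} :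
    k ∈ tile n s ↔ InTile n s (indexHom k) := by
  simpa [tile] using fun h => InTile.mem_freqs h

theorem exists_mem_tile {n : ℕ} (hn : 1 ≤ n) (s : Equiv.Perm (Fin 4)) (k : Fin 3 → ℤ) :
    ∃ k' ∈ tile n s, FccCongr n k k' := by
  obtain ⟨m, hm, h⟩ := exists_inTile n hn s (indexHom k)
  rw [Fin.sum_univ_four] at hm
  refine ⟨![k 0 + n * (m 1 + m 2), k 1 + n * (m 0 + m 2), k 2 + n * (m 0 + m 1)], ?_,
    ![m 1 + m 2, m 0 + m 2, m 0 + m 1], ?_, ?_⟩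
  · rw [mem_tile]
    convert h using 1
    have h3 : m 3 = -m 0 - m 1 - m 2 := by omega
    funext i
    fin_cases i <;> simp [indexHom, h3] <;> ring
  · exact ⟨m 0 + m 1 + m 2, by simp; ring⟩
  · intro i
    fin_cases i <;> simp

theorem tile_unique {n : ℕ} (hn : 1 ≤ n) (s : Equiv.Perm (Fin 4)) {k k' : Fin 3 → ℤ}
    (hk : k ∈ tile n s) (hk' : k' ∈ tile n s) (h : FccCongr n k k') : k = k' := by
  obtain ⟨a, ⟨c, hc⟩, h⟩ := h
  rw [mem_tile] at hk hk'
  -- This is the translation `a` in homogeneous coordinates; evenness of the sum of `a`, equal to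
  -- `2c`, makes it integral.
  have h0 := inTile_unique hn (m := ![c - a 0, c - a 1, c - a 2, -c]) (j := indexHom k) (s := s)
    (by simp [Fin.sum_univ_four]; omega) hk (by
      convert hk' using 1
      have h2 : a 2 = c + c - a 0 - a 1 := by omega
      funext i
      fin_cases i <;> simp [indexHom, h, h2] <;> ring)
  have e0 := congrFun h0 0
  have e1 := congrFun h0 1
  have e2 := congrFun h0 2
  have e3 := congrFun h0 3
  simp at e0 e1 e2 e3
  funext i
  rw [h i]
  have : a i = 0 := by fin_cases i <;> simp <;> omega
  simp [this]

/-- A box of representatives modulo `n` times the face-centred cubic lattice. -/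
noncomputable def box (n : ℕ) : Finset (Fin 3 → ℤ) :=
  Fintype.piFinset ![Finset.Ico 0 (n : ℤ), Finset.Ico 0 (n : ℤ), Finset.Ico 0 (2 * n : ℤ)]

theorem mem_box {n : ℕ} {k : Fin 3 → ℤ} :
    k ∈ box n ↔ (0 ≤ k 0 ∧ k 0 < n) ∧ (0 ≤ k 1 ∧ k 1 < n) ∧ 0 ≤ k 2 ∧ k 2 < 2 * n := by
  simp [box, Fin.forall_fin_succ]

theorem exists_mem_box {n : ℕ} (hn : 1 ≤ n) (k : Fin 3 → ℤ) : ∃ k' ∈ box n, FccCongr n k k' := by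
  have hn' : (0 : ℤ) < n := by positivity
  have hr : ∀ x : ℤ, 0 ≤ x + n * (-(x / n)) ∧ x + n * (-(x / n)) < n := by
    intro x
    have h1 := Int.emod_nonneg x hn'.ne'
    have h2 := Int.emod_lt_of_pos x hn'
    have h3 : x % n = x + n * (-(x / n)) := by rw [Int.emod_def]; ring
    omega
  have h2 : ∃ a2 : ℤ, Even (-(k 0 / n) + -(k 1 / n) + a2) ∧
      0 ≤ k 2 + n * a2 ∧ k 2 + n * a2 < 2 * n := by
    have := hr (k 2)
    -- The last side of the box has length `2n`, which leaves room for one more shift by `n` to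
    -- correct the parity.
    rcases Int.even_or_odd (-(k 0 / n) + -(k 1 / n) + -(k 2 / n)) with h | h
    · exact ⟨_, h, by omega, by omega⟩
    · refine ⟨-(k 2 / n) + 1, ?_, ?_, ?_⟩
      · rw [← add_assoc]; exact h.add_one
      · rw [mul_add]; omega
      · rw [mul_add]; omega
  obtain ⟨a2, ha, hb⟩ := h2
  refine ⟨fun i => k i + n * (![-(k 0 / n), -(k 1 / n), a2] : Fin 3 → ℤ) i, ?_, _, ?_,
    fun i => rfl⟩
  · rw [mem_box]
    exact ⟨hr _, hr _, hb⟩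
  · simpa using ha

theorem box_unique {n : ℕ} {k k' : Fin 3 → ℤ} (hk : k ∈ box n)
    (hk' : k' ∈ box n) (h : FccCongr n k k') : k = k' := by
  obtain ⟨a, he, h⟩ := h
  rw [mem_box] at hk hk'
  have key : ∀ x c y : ℤ, y = x + n * c → |y - x| < n → c = 0 := by
    intro x c y h1 h2
    rw [h1, add_sub_cancel_left] at h2
    exact (mul_eq_zero.1 (Int.eq_zero_of_abs_lt_dvd (dvd_mul_right _ _) h2)).resolve_left
      (by intro h0; rw [h0] at h2; simp at h2)
  have a0 := key _ _ _ (h 0) (by rw [abs_lt]; omega)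
  have a1 := key _ _ _ (h 1) (by rw [abs_lt]; omega)
  rw [a0, a1, zero_add, zero_add] at he
  obtain ⟨c, hc⟩ := he
  have hc0 : c = 0 := by
    have h2 := h 2
    have : k' 2 - k 2 = 2 * n * c := by rw [h2, hc]; ring
    have h3 : |2 * (n : ℤ) * c| < 2 * n := by rw [← this, abs_lt]; omega
    refine (mul_eq_zero.1 (Int.eq_zero_of_abs_lt_dvd (dvd_mul_right _ _) h3)).resolve_left ?_
    intro h0
    rw [h0] at h3
    simp at h3
  have a2 : a 2 = 0 := by omega
  funext i
  rw [h i]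
  fin_cases i <;> simp [a0, a1, a2]

/-- The phase changes by `a · d / 2` full turns. This is an integer: for even `d` trivially, and for
odd `d` because `a · d` has the parity of `a 0 + a 1 + a 2`. -/
theorem expo_pt_eq_of_fccCongr {n : ℕ} (hn : 1 ≤ n) {d : Fin 3 → ℤ}
    (hd : (∀ i, Even (d i)) ∨ ∀ i, Odd (d i)) {k k' : Fin 3 → ℤ} (h : FccCongr n k k') :
    expo k (pt n d) = expo k' (pt n d) := by
  obtain ⟨a, ha, h⟩ := h
  have hn' : (n : ℝ) ≠ 0 := by positivity
  have he : Even (a 0 * d 0 + a 1 * d 1 + a 2 * d 2) := by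
    rcases hd with hd | hd
    · exact (((hd 0).mul_left _).add ((hd 1).mul_left _)).add ((hd 2).mul_left _)
    · have h0 := hd 0
      have h1 := hd 1
      have h2 := hd 2
      rw [← Int.not_even_iff_odd] at h0 h1 h2
      simp only [Int.even_add, Int.even_mul, h0, h1, h2, or_false] at ha ⊢
      exact ha
  obtain ⟨c, hc⟩ := he
  have hsum : (∑ i, (k' i : ℝ) * pt n d i) = (∑ i, (k i : ℝ) * pt n d i) + c := by
    have hc' : (a 0 : ℝ) * d 0 + a 1 * d 1 + a 2 * d 2 = c + c := by exact_mod_cast hc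
    simp only [Fin.sum_univ_three, h, pt]
    push_cast
    field_simp
    linear_combination (n : ℝ) * hc'
  unfold expo
  rw [hsum]
  push_cast
  rw [mul_add, Complex.exp_add]
  have : Complex.exp (2 * π * Complex.I * (c : ℂ)) = 1 := by
    rw [Complex.exp_eq_one_iff]
    exact ⟨c, by ring⟩
  rw [this, mul_one]

/-! ### The kernel at the nodes and the interpolation property -/

theorem sum_weight_expo_pt {n : ℕ} (hn : 1 ≤ n) {d : Fin 3 → ℤ}
    (hd : (∀ i, Even (d i)) ∨ ∀ i, Odd (d i)) :
    ∑ k ∈ freqs n, (weight n (indexHom k) : ℂ) * expo k (pt n d) =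
      ∑ k ∈ box n, expo k (pt n d) := by
  have h1 : ∀ s, ∑ k ∈ tile n s, expo k (pt n d) = ∑ k ∈ box n, expo k (pt n d) := fun s =>
    sum_eq_sum_of_transversal (FccCongr n) (fun _ _ _ h h' => h.trans h')
      _ _ (exists_mem_tile hn s) (exists_mem_box hn) (fun _ hx _ hy h => tile_unique hn s hx hy h)
      (fun _ hx _ hy h => box_unique hx hy h) _ (fun _ _ h => expo_pt_eq_of_fccCongr hn hd h)
  calc ∑ k ∈ freqs n, (weight n (indexHom k) : ℂ) * expo k (pt n d)
      = ∑ k ∈ freqs n, 1 / 24 * ∑ s : Equiv.Perm (Fin 4),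
          if InTile n s (indexHom k) then expo k (pt n d) else 0 := by
        refine Finset.sum_congr rfl fun k hk => ?_
        rw [weight_eq_average hn (indexHom_mem_freqsHom_iff.2 hk)]
        push_cast
        rw [mul_assoc, Finset.sum_mul]
        congr 1
        refine Finset.sum_congr rfl fun s _ => ?_
        split_ifs <;> simp
    _ = 1 / 24 * ∑ s : Equiv.Perm (Fin 4), ∑ k ∈ tile n s, expo k (pt n d) := by
        rw [← Finset.mul_sum, Finset.sum_comm]
        simp only [tile, Finset.sum_filter]
    _ = ∑ k ∈ box n, expo k (pt n d) := by
        simp only [h1, Finset.sum_const, Finset.card_univ, Fintype.card_perm, Fintype.card_fin]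
        simp [Nat.factorial]

theorem sum_Ico_exp_div {N : ℕ} (hN : 1 ≤ N) (d : ℤ) :
    ∑ v ∈ Finset.Ico 0 (N : ℤ), Complex.exp (2 * π * Complex.I * ((v : ℂ) * (d / N))) =
      if (N : ℤ) ∣ d then (N : ℂ) else 0 := by
  have hN' : (N : ℂ) ≠ 0 := by exact_mod_cast (by omega : N ≠ 0)
  set z := Complex.exp (2 * π * Complex.I * ((d : ℂ) / N)) with hz
  have h1 : ∑ v ∈ Finset.Ico 0 (N : ℤ), Complex.exp (2 * π * Complex.I * ((v : ℂ) * (d / N))) =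
      ∑ v ∈ Finset.range N, z ^ v := by
    refine Finset.sum_bij' (fun v _ => v.toNat) (fun v _ => (v : ℤ)) ?_ ?_ ?_ ?_ ?_
    · intro v hv; simp at hv ⊢; omega
    · intro v hv; simp at hv ⊢; omega
    · intro v hv; simp at hv ⊢; omega
    · intro v hv; simp
    · intro v hv
      simp only [Finset.mem_Ico] at hv
      lift v to ℕ using hv.1
      rw [hz, ← Complex.exp_nat_mul]
      congr 1
      simp
      ring
  have hzN : z ^ N = 1 := by
    rw [hz, ← Complex.exp_nat_mul, Complex.exp_eq_one_iff]
    exact ⟨d, by field_simp⟩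
  have hz1 : z = 1 ↔ (N : ℤ) ∣ d := by
    rw [hz, Complex.exp_eq_one_iff]
    constructor
    · rintro ⟨m, hm⟩
      refine ⟨m, ?_⟩
      have h2 : (2 * π * Complex.I : ℂ) ≠ 0 := Complex.two_pi_I_ne_zero
      have h3 : (d : ℂ) / N = m := mul_left_cancel₀ h2 (by rw [hm]; ring)
      rw [div_eq_iff hN'] at h3
      have h4 : (d : ℂ) = ((m * N : ℤ) : ℂ) := by push_cast; exact h3
      rw [mul_comm]
      exact_mod_cast h4
    · rintro ⟨m, rfl⟩
      exact ⟨m, by push_cast; field_simp⟩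
  rw [h1]
  split_ifs with h
  · rw [hz1.2 h]; simp
  · have h5 := mul_neg_geom_sum z N
    rw [hzN, sub_self] at h5
    exact (mul_eq_zero.1 h5).resolve_left (sub_ne_zero.2 fun h0 => h (hz1.1 h0.symm))

theorem sum_box_expo_pt {n : ℕ} (hn : 1 ≤ n) {d : Fin 3 → ℤ}
    (hd : (∀ i, Even (d i)) ∨ ∀ i, Odd (d i)) :
    ∑ k ∈ box n, expo k (pt n d) = if ∀ i, (2 * n : ℤ) ∣ d i then 2 * (n : ℂ) ^ 3 else 0 := by
  have hn' : (n : ℂ) ≠ 0 := by exact_mod_cast (by omega : n ≠ 0)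
  have h1 : ∑ k ∈ box n, expo k (pt n d) = ∏ i : Fin 3, ∑ v ∈ (![Finset.Ico 0 (n : ℤ),
      Finset.Ico 0 (n : ℤ), Finset.Ico 0 (2 * n : ℤ)] : Fin 3 → Finset ℤ) i,
        Complex.exp (2 * π * Complex.I * ((v : ℂ) * (d i / (2 * n)))) := by
    rw [Finset.prod_univ_sum]
    refine Finset.sum_congr rfl fun k _ => ?_
    rw [← Complex.exp_sum, ← Finset.mul_sum]
    simp [expo, pt]
  have h2 := sum_Ico_exp_div (N := 2 * n) (by omega) (d 2)
  push_cast at h2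
  rw [h1, Fin.prod_univ_three]
  simp only [Matrix.cons_val]
  rw [h2]
  -- Only the third geometric sum runs over a full period for every parity. If it survives, `d 2` is
  -- even, hence all of `d` is, and the two sums of length `n` become full periods as well.
  by_cases hd2 : (2 * n : ℤ) ∣ d 2
  · have hev : ∀ i, Even (d i) := by
      rcases hd with hd | hd
      · exact hd
      · exact absurd ((even_two_mul _).trans_dvd hd2) (Int.not_even_iff_odd.2 (hd 2))
    choose e he using hev
    have h3 : ∀ i, ∑ v ∈ Finset.Ico 0 (n : ℤ),
        Complex.exp (2 * π * Complex.I * ((v : ℂ) * (d i / (2 * n)))) =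
          if (2 * n : ℤ) ∣ d i then (n : ℂ) else 0 := by
      intro i
      have h4 := sum_Ico_exp_div hn (e i)
      have h5 : (2 * n : ℤ) ∣ d i ↔ (n : ℤ) ∣ e i := by
        rw [he i, ← two_mul]
        exact mul_dvd_mul_iff_left two_ne_zero
      simp only [h5]
      rw [← h4]
      refine Finset.sum_congr rfl fun v _ => ?_
      have : (d i : ℂ) / (2 * n) = e i / n := by
        rw [he i]; push_cast; field_simp; ring
      rw [this]
    rw [h3, h3]
    have h6 : (∀ i, (2 * n : ℤ) ∣ d i) ↔ (2 * n : ℤ) ∣ d 0 ∧ (2 * n : ℤ) ∣ d 1 := by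
      simp [Fin.forall_fin_succ, hd2]
    simp only [h6, hd2, if_true]
    by_cases c0 : (2 * n : ℤ) ∣ d 0 <;> by_cases c1 : (2 * n : ℤ) ∣ d 1 <;> simp [c0, c1]
    ring
  · have h7 : ¬ ∀ i, (2 * n : ℤ) ∣ d i := fun h => hd2 (h 2)
    simp [h7, hd2]

theorem kernel_pt {n : ℕ} (hn : 1 ≤ n) {d : Fin 3 → ℤ}
    (hd : (∀ i, Even (d i)) ∨ ∀ i, Odd (d i)) :
    kernel n (pt n d) = if ∀ i, (2 * n : ℤ) ∣ d i then 1 else 0 := by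
  have hn' : (n : ℂ) ≠ 0 := by exact_mod_cast (by omega : n ≠ 0)
  rw [kernel, sum_weight_expo_pt hn hd, sum_box_expo_pt hn hd]
  split_ifs
  · field_simp
  · simp

theorem pt_sub_pt (n : ℕ) (j k : Fin 3 → ℤ) : pt n j - pt n k = pt n (j - k) := by
  funext i
  simp [pt, sub_div]

theorem mem_congrNodes_iff {n : ℕ} (hn : 1 ≤ n) {j k : Fin 3 → ℤ} :
    k ∈ congrNodes n j ↔ k ∈ nodes n ∧ ∀ i, (2 * n : ℤ) ∣ (j - k) i := by
  have hn' : (2 * n : ℝ) ≠ 0 := by positivity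
  simp only [congrNodes, Finset.mem_filter, and_congr_right_iff]
  intro _
  have key : ∀ i (m : ℤ), pt n k i - pt n j i = m ↔ k i - j i = 2 * n * m := by
    intro i m
    simp only [pt]
    rw [← sub_div, div_eq_iff hn', mul_comm (m : ℝ)]
    exact_mod_cast Iff.rfl
  simp only [key]
  constructor
  · rintro ⟨m, hm⟩ i
    exact ⟨-m i, by simp only [Pi.sub_apply]; linarith [hm i]⟩
  · intro h
    choose m hm using h
    exact ⟨-m, fun i => by have := hm i; simp at this ⊢; linarith⟩

theorem interp_pt {n : ℕ} (hn : 1 ≤ n) (f : (Fin 3 → ℝ) → ℂ) {j : Fin 3 → ℤ}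
    (hj : j ∈ nodes n) : interp n f (pt n j) = ∑ k ∈ congrNodes n j, f (pt n k) := by
  classical
  have h1 : ∀ k ∈ nodes n, kernel n (pt n j - pt n k) =
      if k ∈ congrNodes n j then 1 else 0 := by
    intro k hk
    have hpar : (∀ i, Even ((j - k) i)) ∨ ∀ i, Odd ((j - k) i) := by
      rcases (Finset.mem_filter.1 hj).2 with h | h <;> rcases (Finset.mem_filter.1 hk).2 with h' | h'
      · exact Or.inl fun i => (h i).sub (h' i)
      · exact Or.inr fun i => (h i).sub_odd (h' i)
      · exact Or.inr fun i => (h i).sub_even (h' i)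
      · exact Or.inl fun i => (h i).sub_odd (h' i)
    rw [pt_sub_pt, kernel_pt hn hpar]
    simp only [mem_congrNodes_iff hn, hk, true_and]
  unfold interp
  rw [Finset.sum_congr rfl fun k hk => by rw [h1 k hk]]
  simp only [mul_ite, mul_one, mul_zero]
  rw [← Finset.sum_filter]
  congr 1
  ext k
  simp only [Finset.mem_filter, and_iff_right_iff_imp]
  exact fun h => ((mem_congrNodes_iff hn).1 h).1

/-- Each coordinate of an interior node differs by less than `2n` from that of any other node. -/
theorem congrNodes_eq_singleton {n : ℕ} (hn : 1 ≤ n) {j : Fin 3 → ℤ}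
    (hj : j ∈ interiorNodes n) : congrNodes n j = {j} := by
  ext k
  rw [mem_congrNodes_iff hn, Finset.mem_singleton]
  simp only [interiorNodes, nodes, Finset.mem_filter, Finset.mem_Icc, Pi.le_def] at hj ⊢
  constructor
  · rintro ⟨⟨⟨h1, h2⟩, -⟩, h⟩
    funext i
    have := Int.eq_zero_of_abs_lt_dvd (h i) (by
      have := h1 i
      have := h2 i
      have := hj.2 i
      rw [abs_lt]
      simp only [Pi.sub_apply]
      omega)
    simp only [Pi.sub_apply] at this
    omega
  · rintro rfl
    exact ⟨hj.1, by simp⟩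

/-! ### Homogeneous coordinates and the symmetry under negation -/

theorem expo_eq_expoHom (k : Fin 3 → ℤ) (x : Fin 3 → ℝ) :
    expo k x = expoHom (indexHom k) (toHom x) := by
  unfold expo expoHom
  congr 1
  simp only [Fin.sum_univ_three, Fin.sum_univ_four, indexHom, toHom, Matrix.cons_val]
  push_cast
  ring

theorem kernel_eq_kernelHom (n : ℕ) (x : Fin 3 → ℝ) : kernel n x = kernelHom n (toHom x) := by
  unfold kernel kernelHom
  rw [sum_freqsHom]
  simp only [expo_eq_expoHom]

theorem sum_toHom (x : Fin 3 → ℝ) : ∑ i, toHom x i = 0 := by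
  simp only [Fin.sum_univ_four, toHom, Matrix.cons_val]
  ring

theorem toHom_ofHom {t : Fin 4 → ℝ} (ht : ∑ i, t i = 0) : toHom (ofHom t) = t := by
  rw [Fin.sum_univ_four] at ht
  funext i
  fin_cases i <;> simp [toHom, ofHom] <;> linarith

theorem expoHom_neg (j : Fin 4 → ℤ) (t : Fin 4 → ℝ) : expoHom (-j) t = expoHom j (-t) := by
  simp [expoHom]

theorem expoHom_conj (j : Fin 4 → ℤ) (t : Fin 4 → ℝ) :
    starRingEnd ℂ (expoHom j t) = expoHom (-j) t := by
  unfold expoHom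
  rw [← Complex.exp_conj]
  congr 1
  simp [Complex.conj_ofReal, Complex.conj_ofNat]
  ring

theorem neg_mem_freqsHom {n : ℕ} {j : Fin 4 → ℤ} (hj : j ∈ freqsHom n) : -j ∈ freqsHom n := by
  rw [mem_freqsHom_iff] at hj ⊢
  obtain ⟨h0, h4, h2, h⟩ := hj
  refine ⟨by simp [h0], fun a b => (h4 a b).neg, fun a => by simpa using (h2 a).neg,
    fun a b => ?_⟩
  have := h a b
  simp only [Pi.neg_apply]
  omega

theorem sum_freqsHom_neg {β : Type*} [AddCommMonoid β] (n : ℕ) (f : (Fin 4 → ℤ) → β) :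
    ∑ j ∈ freqsHom n, f (-j) = ∑ j ∈ freqsHom n, f j :=
  Finset.sum_bij' (fun j _ => -j) (fun j _ => -j) (fun _ h => neg_mem_freqsHom h)
    (fun _ h => neg_mem_freqsHom h) (fun _ _ => neg_neg _) (fun _ _ => neg_neg _)
    (fun _ _ => rfl)

theorem partialSum_im (n : ℕ) (t : Fin 4 → ℝ) : (partialSum n t).im = 0 := by
  rw [← Complex.conj_eq_iff_im]
  unfold partialSum
  rw [map_sum]
  simp only [expoHom_conj]
  exact sum_freqsHom_neg n fun j => expoHom j t

theorem topSet_neg (n : ℕ) (j : Fin 4 → ℤ) : topSet n (-j) = botSet n j := by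
  ext i
  rw [mem_topSet, mem_botSet]
  simp only [Pi.neg_apply, sub_neg_eq_add, neg_add_eq_sub]

theorem botSet_neg (n : ℕ) (j : Fin 4 → ℤ) : botSet n (-j) = topSet n j := by
  rw [← topSet_neg, neg_neg]

/-! ### Decomposition of the weighted sum by boundary elements -/

/-- The part of the sum `D_n^*` over the boundary element indexed by `(I, J)`. -/
noncomputable def elementSum (n : ℕ) (I J : Finset (Fin 4)) (t : Fin 4 → ℝ) : ℂ :=
  ∑ j ∈ freqsHom n, if topSet n j = I ∧ botSet n j = J then expoHom j t else 0

theorem elementSum_swap (n : ℕ) (I J : Finset (Fin 4)) (t : Fin 4 → ℝ) :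
    elementSum n J I t = elementSum n I J (-t) := by
  unfold elementSum
  rw [← sum_freqsHom_neg]
  refine Finset.sum_congr rfl fun j _ => ?_
  rw [topSet_neg, botSet_neg, expoHom_neg]
  exact if_congr and_comm rfl rfl

/-- The corrections are `1/2 - 1/3 = 1/6` on edges, `1/2 - 1/4 = 1/4` on vertices of types (1,3) and
(3,1), and `1/2 - 1/6 = 1/3` on those of type (2,2). The last appears as `1/6` because each such
vertex is listed twice, once through `I` and once through `J`. -/
theorem choose_inv_eq (I J : Finset (Fin 4)) (h : Disjoint I J) (h' : I.Nonempty ↔ J.Nonempty) :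
    (1 / ((I.card + J.card).choose I.card : ℚ)) = 1 / 2 * (1 + if I = ∅ then 1 else 0) -
      (1 / 6 * ∑ ν : Fin 4, ∑ i ∈ Finset.univ.erase ν,
          ((if I = {i} ∧ J = {ν, i}ᶜ then 1 else 0) + if I = {ν, i}ᶜ ∧ J = {i} then 1 else 0)
        + 1 / 4 * ∑ i : Fin 4,
          ((if I = {i} ∧ J = {i}ᶜ then 1 else 0) + if I = {i}ᶜ ∧ J = {i} then 1 else 0)
        + 1 / 6 * ∑ ν : Fin 4, ∑ μ ∈ Finset.univ.filter (fun μ => μ < ν),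
          ((if I = {μ, ν} ∧ J = {μ, ν}ᶜ then 1 else 0) +
            if I = {μ, ν}ᶜ ∧ J = {μ, ν} then 1 else 0)) := by
  revert I J
  decide +kernel

/-- Differences of entries are multiples of 4, so being below `4n` means being at most `4(n - 1)`.
-/
theorem sum_topSet_empty {n : ℕ} (hn : 1 ≤ n) (t : Fin 4 → ℝ) :
    (∑ j ∈ freqsHom n, if topSet n j = ∅ then expoHom j t else 0) = partialSum (n - 1) t := by
  rw [← Finset.sum_filter, partialSum]
  congr 1
  ext j
  simp only [Finset.mem_filter, Finset.eq_empty_iff_forall_notMem, mem_topSet, not_exists,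
    mem_freqsHom_iff]
  have hc : ((n - 1 : ℕ) : ℤ) = n - 1 := by omega
  rw [hc]
  constructor
  · rintro ⟨⟨h0, h4, h2, h⟩, hne⟩
    refine ⟨h0, h4, h2, fun a b => ?_⟩
    have h1 := h4 a b
    have h3 := h a b
    have h5 := hne a b
    have h6 := hne b a
    simp only [Int.ModEq] at h1
    omega
  · rintro ⟨h0, h4, h2, h⟩
    refine ⟨⟨h0, h4, h2, fun a b => ?_⟩, fun a b => ?_⟩
    · have := h a b
      omega
    · have := h a b
      omega

theorem sum_weight_expoHom {n : ℕ} (hn : 1 ≤ n) (t : Fin 4 → ℝ) :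
    ∑ j ∈ freqsHom n, (weight n j : ℂ) * expoHom j t =
      1 / 2 * (partialSum n t + partialSum (n - 1) t) -
      (1 / 6 * ∑ ν : Fin 4, ∑ i ∈ Finset.univ.erase ν,
          (elementSum n {i} {ν, i}ᶜ t + elementSum n {ν, i}ᶜ {i} t)
        + 1 / 4 * ∑ i : Fin 4, (elementSum n {i} {i}ᶜ t + elementSum n {i}ᶜ {i} t)
        + 1 / 6 * ∑ ν : Fin 4, ∑ μ ∈ Finset.univ.filter (fun μ => μ < ν),
          (elementSum n {μ, ν} {μ, ν}ᶜ t + elementSum n {μ, ν}ᶜ {μ, ν} t)) := by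
  have h1 : ∀ j ∈ freqsHom n, (weight n j : ℂ) * expoHom j t =
      1 / 2 * (expoHom j t + if topSet n j = ∅ then expoHom j t else 0) -
      (1 / 6 * ∑ ν : Fin 4, ∑ i ∈ Finset.univ.erase ν,
          ((if topSet n j = {i} ∧ botSet n j = {ν, i}ᶜ then expoHom j t else 0) +
            if topSet n j = {ν, i}ᶜ ∧ botSet n j = {i} then expoHom j t else 0)
        + 1 / 4 * ∑ i : Fin 4,
          ((if topSet n j = {i} ∧ botSet n j = {i}ᶜ then expoHom j t else 0) +
            if topSet n j = {i}ᶜ ∧ botSet n j = {i} then expoHom j t else 0)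
        + 1 / 6 * ∑ ν : Fin 4, ∑ μ ∈ Finset.univ.filter (fun μ => μ < ν),
          ((if topSet n j = {μ, ν} ∧ botSet n j = {μ, ν}ᶜ then expoHom j t else 0) +
            if topSet n j = {μ, ν}ᶜ ∧ botSet n j = {μ, ν} then expoHom j t else 0)) := by
    intro j hj
    have h2 := choose_inv_eq _ _ (disjoint_topSet_botSet hn hj) topSet_nonempty_iff
    have h3 := congrArg (fun q : ℚ => (q : ℂ)) h2
    have h4 : ∀ (P : Prop) [Decidable P],
        (if P then expoHom j t else 0) = (if P then 1 else 0) * expoHom j t := by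
      intro P _
      rw [ite_mul, one_mul, zero_mul]
    have h6 : ∀ (P : Prop) [Decidable P],
        (((if P then 1 else 0 : ℚ)) : ℂ) = if P then 1 else 0 := by
      intro P _
      split_ifs <;> simp
    simp only [h4, ← add_mul, ← Finset.sum_mul]
    rw [weight_eq hn hj]
    push_cast at h3 ⊢
    simp only [h6] at h3
    linear_combination expoHom j t * h3
  have h5 : ∀ (s : Fin 4 → Finset (Fin 4)) (f : (Fin 4 → ℤ) → Fin 4 → Fin 4 → ℂ),
      ∑ ν : Fin 4, ∑ i ∈ s ν, ∑ j ∈ freqsHom n, f j ν i =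
        ∑ j ∈ freqsHom n, ∑ ν : Fin 4, ∑ i ∈ s ν, f j ν i := by
    intro s f
    rw [Finset.sum_comm]
    exact Finset.sum_congr rfl fun ν _ => Finset.sum_comm
  rw [Finset.sum_congr rfl h1, ← sum_topSet_empty hn]
  simp only [elementSum, partialSum, ← Finset.sum_add_distrib, h5]
  rw [Finset.sum_comm (s := Finset.univ) (t := freqsHom n)]
  simp only [Finset.mul_sum (freqsHom n), ← Finset.sum_add_distrib, ← Finset.sum_sub_distrib]

/-! ### Edge and vertex sums -/

theorem sinQuot_mul_sin (m : ℕ) (s : ℝ) : sinQuot m s * Real.sin s = Real.sin (m * s) := by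
  induction m with
  | zero => simp [sinQuot]
  | succ m ih =>
    rw [sinQuot_succ]
    push_cast
    rw [add_mul (m : ℝ), one_mul, Real.sin_add, ← ih]
    ring

/-- The angles are equally spaced and centred at `b`. Removing the last one moves the centre to `b +
s`, so the induction needs `b` to be arbitrary. -/
theorem sum_range_cos (m : ℕ) (b s : ℝ) :
    ∑ l ∈ Finset.range m, Real.cos (b + (m - 1 - 2 * l) * s) = sinQuot m s * Real.cos b := by
  induction m generalizing b with
  | zero => simp [sinQuot]
  | succ m ih =>
    rw [Finset.sum_range_succ, sinQuot_succ]
    have h1 : ∑ l ∈ Finset.range m, Real.cos (b + ((m + 1 : ℕ) - 1 - 2 * l) * s) =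
        ∑ l ∈ Finset.range m, Real.cos ((b + s) + (m - 1 - 2 * l) * s) := by
      refine Finset.sum_congr rfl fun l _ => ?_
      congr 1
      push_cast
      ring
    have h2 : b + (((m + 1 : ℕ) : ℝ) - 1 - 2 * m) * s = b - m * s := by push_cast; ring
    rw [h1, ih, h2, Real.cos_add, Real.cos_sub, ← sinQuot_mul_sin]
    ring

theorem exists_other_indices {i ν : Fin 4} (h : i ≠ ν) : ∃ a b : Fin 4,
    a ≠ b ∧ a ≠ i ∧ a ≠ ν ∧ b ≠ i ∧ b ≠ ν ∧ ∀ x, x = i ∨ x = ν ∨ x = a ∨ x = b := by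
  revert i ν
  decide

theorem topSet_botSet_of_sub_iff {n : ℕ} {j : Fin 4 → ℤ} {I J : Finset (Fin 4)} (hI : I.Nonempty)
    (hJ : J.Nonempty) (h : ∀ x y, j x - j y = 4 * n ↔ x ∈ I ∧ y ∈ J) :
    topSet n j = I ∧ botSet n j = J := by
  obtain ⟨i, hi⟩ := hI
  obtain ⟨l, hl⟩ := hJ
  constructor
  · ext x
    simp only [mem_topSet, h]
    exact ⟨fun ⟨_, hx⟩ => hx.1, fun hx => ⟨l, hx, hl⟩⟩
  · ext x
    simp only [mem_botSet, h]
    exact ⟨fun ⟨_, hx⟩ => hx.2, fun hx => ⟨i, hi, hx⟩⟩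

theorem sum_fin_four_eq {β : Type*} [AddCommMonoid β] {i ν a b : Fin 4} (h : i ≠ ν) (hab : a ≠ b)
    (hai : a ≠ i) (haν : a ≠ ν) (hbi : b ≠ i) (hbν : b ≠ ν)
    (hall : ∀ x, x = i ∨ x = ν ∨ x = a ∨ x = b) (f : Fin 4 → β) :
    ∑ x, f x = f i + (f ν + (f a + f b)) := by
  have : (Finset.univ : Finset (Fin 4)) = {i, ν, a, b} := by
    ext x
    simpa using hall x
  rw [this, Finset.sum_insert, Finset.sum_insert, Finset.sum_insert, Finset.sum_singleton]
  all_goals simp [h, hab, hai.symm, haν.symm, hbi.symm, hbν.symm]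

/-- The frequencies on the edge with `I = {i}` and `J = {ν, i}ᶜ`. -/
def edgeFreq (n : ℕ) (i ν : Fin 4) (l : ℕ) : Fin 4 → ℤ := fun x =>
  if x = i then 2 * n + 2 * (l + 1) else if x = ν then 2 * n - 6 * (l + 1)
    else -2 * n + 2 * (l + 1)

/-- Two maximal differences and the zero sum leave the single parameter `j i = 2n + 2(l + 1)`.
Non-maximality of the differences `j ν - j a` and `j i - j ν`, with `a` outside `{i, ν}`, says `0 <
8(l + 1) < 4n`, which gives the range of `l`. -/
theorem mem_edge_iff {n : ℕ} (hn : 1 ≤ n) {i ν : Fin 4} (h : i ≠ ν) (j : Fin 4 → ℤ) :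
    (j ∈ freqsHom n ∧ topSet n j = {i} ∧ botSet n j = {ν, i}ᶜ) ↔
      ∃ l ∈ Finset.range ((n - 1) / 2), edgeFreq n i ν l = j := by
  obtain ⟨a, b, hab, hai, haν, hbi, hbν, hall⟩ := exists_other_indices h
  have hsum := fun f : Fin 4 → ℤ => sum_fin_four_eq h hab hai haν hbi hbν hall f
  constructor
  · rintro ⟨hj, h1, h2⟩
    have e : ∀ x y, j x - j y = 4 * n ↔ x = i ∧ (y ≠ ν ∧ y ≠ i) := by
      intro x y
      rw [sub_eq_iff hj, h1, h2]
      simp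
    have e1 := (e i a).2 ⟨rfl, haν, hai⟩
    have e2 := (e i b).2 ⟨rfl, hbν, hbi⟩
    have e3 : ¬ (j i - j ν = 4 * n) := by rw [e]; simp
    have e4 : ¬ (j ν - j a = 4 * n) := by rw [e]; simp [h.symm]
    have l1 := sub_le_of_mem_freqsHom hj i ν
    have l2 := sub_le_of_mem_freqsHom hj ν a
    obtain ⟨h0, -, hev, -⟩ := (mem_freqsHom_iff n j).1 hj
    rw [hsum] at h0
    have hi := hev i
    simp only [Int.ModEq] at hi
    refine ⟨((j i - 2 * n) / 2 - 1).toNat, ?_, ?_⟩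
    · rw [Finset.mem_range]
      omega
    · funext x
      rcases hall x with rfl | rfl | rfl | rfl <;>
        simp [edgeFreq, h.symm, hai, haν, hbi, hbν] <;> omega
  · rintro ⟨l, hl, rfl⟩
    rw [Finset.mem_range] at hl
    have vi : edgeFreq n i ν l i = 2 * n + 2 * (l + 1) := by simp [edgeFreq]
    have vν : edgeFreq n i ν l ν = 2 * n - 6 * (l + 1) := by simp [edgeFreq, h.symm]
    have va : edgeFreq n i ν l a = -2 * n + 2 * (l + 1) := by simp [edgeFreq, hai, haν]
    have vb : edgeFreq n i ν l b = -2 * n + 2 * (l + 1) := by simp [edgeFreq, hbi, hbν]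
    have e : ∀ x y, edgeFreq n i ν l x - edgeFreq n i ν l y = 4 * n ↔
        x ∈ ({i} : Finset (Fin 4)) ∧ y ∈ ({ν, i} : Finset (Fin 4))ᶜ := by
      intro x y
      simp only [Finset.mem_singleton, Finset.mem_compl, Finset.mem_insert, not_or]
      rcases hall x with rfl | rfl | rfl | rfl <;> rcases hall y with rfl | rfl | rfl | rfl <;>
        simp only [vi, vν, va, vb, h, h.symm, hai, haν, hbi, hbν, not_true, not_false_iff,
          and_true, and_false, and_self, iff_true, iff_false] <;> omega
    refine ⟨(mem_freqsHom_iff n _).2 ⟨?_, ?_, ?_, ?_⟩, topSet_botSet_of_sub_iff ⟨i, by simp⟩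
      ⟨a, by simp [hai, haν]⟩ e⟩
    · rw [hsum]; omega
    · intro x y
      rcases hall x with rfl | rfl | rfl | rfl <;> rcases hall y with rfl | rfl | rfl | rfl <;>
        simp only [vi, vν, va, vb, Int.ModEq] <;> omega
    · intro x
      rcases hall x with rfl | rfl | rfl | rfl <;>
        simp only [vi, vν, va, vb, Int.ModEq] <;> omega
    · intro x y
      rcases hall x with rfl | rfl | rfl | rfl <;> rcases hall y with rfl | rfl | rfl | rfl <;>
        simp only [vi, vν, va, vb] <;> omega

theorem elementSum_edge {n : ℕ} (hn : 1 ≤ n) {i ν : Fin 4} (h : i ≠ ν) {t : Fin 4 → ℝ}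
    (ht : ∑ x, t x = 0) : elementSum n {i} {ν, i}ᶜ t = ∑ l ∈ Finset.range ((n - 1) / 2),
      Complex.exp (((2 * π * (n * t i + (n - 2 * (l + 1)) * t ν) : ℝ) : ℂ) * Complex.I) := by
  obtain ⟨a, b, hab, hai, haν, hbi, hbν, hall⟩ := exists_other_indices h
  unfold elementSum
  rw [← Finset.sum_filter]
  symm
  refine Finset.sum_bij (fun l _ => edgeFreq n i ν l) ?_ ?_ ?_ ?_
  · intro l hl
    rw [Finset.mem_filter]
    exact (mem_edge_iff hn h _).2 ⟨l, hl, rfl⟩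
  · intro l _ l' _ hll
    have := congrFun hll i
    simp [edgeFreq] at this
    exact this
  · intro j hj
    rw [Finset.mem_filter] at hj
    obtain ⟨l, hl, e⟩ := (mem_edge_iff hn h _).1 hj
    exact ⟨l, hl, e⟩
  · intro l _
    unfold expoHom
    rw [sum_fin_four_eq h hab hai haν hbi hbν hall] at ht ⊢
    have hb : t b = -t i - t ν - t a := by linarith
    congr 1
    simp [edgeFreq, h.symm, hai, haν, hbi, hbν, hb]
    ring

theorem ofReal_two_mul_cos (a : ℝ) : ((2 * Real.cos a : ℝ) : ℂ) =
    Complex.exp ((a : ℂ) * Complex.I) + Complex.exp (((-a : ℝ) : ℂ) * Complex.I) := by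
  rw [Complex.ofReal_mul, Complex.ofReal_cos, Complex.ofReal_ofNat, Complex.two_cos,
    Complex.ofReal_neg]

theorem elementSum_edge_add_swap {n : ℕ} (hn : 1 ≤ n) {i ν : Fin 4} (h : i ≠ ν) {t : Fin 4 → ℝ}
    (ht : ∑ x, t x = 0) : elementSum n {i} {ν, i}ᶜ t + elementSum n {ν, i}ᶜ {i} t =
      ((2 * (sinQuot ((n - 1) / 2) (2 * π * t ν) *
        Real.cos (2 * π * (n * t i + ((n / 2 : ℕ) : ℝ) * t ν))) : ℝ) : ℂ) := by
  rw [elementSum_swap n {i}, elementSum_edge hn h ht,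
    elementSum_edge hn h (t := -t) (by simp [ht]), ← Finset.sum_add_distrib, ← sum_range_cos,
    Finset.mul_sum, Complex.ofReal_sum]
  refine Finset.sum_congr rfl fun l hl => ?_
  -- The coefficients `n - 2(l + 1)` of `t ν` are centred at `n - 1 - ⌊(n-1)/2⌋ = ⌊n/2⌋`.
  have hq : (((n - 1) / 2 : ℕ) : ℝ) = n - 1 - (n / 2 : ℕ) := by
    rw [eq_sub_iff_add_eq, eq_sub_iff_add_eq]
    exact_mod_cast (by omega : (n - 1) / 2 + n / 2 + 1 = n)
  have ha : 2 * π * (n * t i + ((n / 2 : ℕ) : ℝ) * t ν) +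
      ((n : ℝ) - 1 - (n / 2 : ℕ) - 1 - 2 * l) * (2 * π * t ν) =
        2 * π * (n * t i + (n - 2 * (l + 1)) * t ν) := by ring
  have hb : 2 * π * (n * (-t) i + (n - 2 * (l + 1)) * (-t) ν) =
      -(2 * π * (n * t i + (n - 2 * (l + 1)) * t ν)) := by
    simp only [Pi.neg_apply]
    ring
  rw [hq, ha, hb, ofReal_two_mul_cos]

/-- Three maximal differences and the zero sum force the entries `3n` and `-n`; these are admissible
exactly when they are even. -/
theorem mem_vertex_iff {n : ℕ} (hn : 1 ≤ n) (i : Fin 4) (j : Fin 4 → ℤ) :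
    (j ∈ freqsHom n ∧ topSet n j = {i} ∧ botSet n j = {i}ᶜ) ↔
      Even n ∧ j = fun x => if x = i then 3 * (n : ℤ) else -n := by
  obtain ⟨ν, h⟩ : ∃ ν, i ≠ ν := by
    revert i
    decide
  obtain ⟨a, b, hab, hai, haν, hbi, hbν, hall⟩ := exists_other_indices h
  have hsum := fun f : Fin 4 → ℤ => sum_fin_four_eq h hab hai haν hbi hbν hall f
  constructor
  · rintro ⟨hj, h1, h2⟩
    have e : ∀ y, y ≠ i → j i - j y = 4 * n := by
      intro y hy
      rw [sub_eq_iff hj, h1, h2]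
      simp [hy]
    have e1 := e ν h.symm
    have e2 := e a hai
    have e3 := e b hbi
    obtain ⟨h0, -, hev, -⟩ := (mem_freqsHom_iff n j).1 hj
    rw [hsum] at h0
    have hν := hev ν
    simp only [Int.ModEq] at hν
    refine ⟨?_, ?_⟩
    · rw [Nat.even_iff]
      omega
    · funext x
      by_cases hx : x = i
      · simp only [hx, if_true]
        omega
      · have := e x hx
        simp only [hx, if_false]
        omega
  · rintro ⟨he, rfl⟩
    have hn' : (n : ℤ) % 2 = 0 := by
      rw [Nat.even_iff] at he
      omega
    have e : ∀ x y, (if x = i then 3 * (n : ℤ) else -n) - (if y = i then 3 * (n : ℤ) else -n) =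
        4 * n ↔ x ∈ ({i} : Finset (Fin 4)) ∧ y ∈ ({i} : Finset (Fin 4))ᶜ := by
      intro x y
      simp only [Finset.mem_singleton, Finset.mem_compl]
      split_ifs <;> simp [*] <;> omega
    refine ⟨(mem_freqsHom_iff n _).2 ⟨?_, ?_, ?_, ?_⟩, topSet_botSet_of_sub_iff ⟨i, by simp⟩
      ⟨ν, by simp [h.symm]⟩ e⟩
    · rw [hsum]
      simp only [if_true, h.symm, hai, hbi, if_false]
      ring
    · intro x y
      simp only [Int.ModEq]
      split_ifs <;> omega
    · intro x
      simp only [Int.ModEq]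
      split_ifs <;> omega
    · intro x y
      split_ifs <;> omega

theorem elementSum_vertex {n : ℕ} (hn : 1 ≤ n) (i : Fin 4) {t : Fin 4 → ℝ}
    (ht : ∑ x, t x = 0) : elementSum n {i} {i}ᶜ t + elementSum n {i}ᶜ {i} t =
      ((2 * (if Even n then Real.cos (2 * π * n * t i) else 0) : ℝ) : ℂ) := by
  have key : ∀ t : Fin 4 → ℝ, ∑ x, t x = 0 → elementSum n {i} {i}ᶜ t =
      if Even n then Complex.exp (((2 * π * n * t i : ℝ) : ℂ) * Complex.I) else 0 := by
    intro t ht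
    unfold elementSum
    rw [← Finset.sum_filter]
    split_ifs with he
    · rw [Finset.sum_eq_single_of_mem _ (Finset.mem_filter.2 ((mem_vertex_iff hn i _).2 ⟨he, rfl⟩))]
      · unfold expoHom
        have h1 : ∑ x, (((if x = i then 3 * (n : ℤ) else -n : ℤ) : ℝ) * t x) = 4 * n * t i := by
          have h2 : ∀ x, (((if x = i then 3 * (n : ℤ) else -n : ℤ) : ℝ) * t x) =
              -n * t x + if x = i then 4 * n * t x else 0 := by
            intro x
            split_ifs
            · push_cast
              ring
            · simp
          simp only [h2, Finset.sum_add_distrib, ← Finset.mul_sum, ht]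
          simp
        rw [h1]
        congr 1
        push_cast
        ring
      · intro j hj hne
        exact absurd ((mem_vertex_iff hn i j).1 (Finset.mem_filter.1 hj)).2 hne
    · refine Finset.sum_eq_zero fun j hj => ?_
      exact absurd ((mem_vertex_iff hn i j).1 (Finset.mem_filter.1 hj)).1 he
  rw [elementSum_swap n {i}, key t ht, key (-t) (by simp [ht])]
  split_ifs
  · rw [ofReal_two_mul_cos]
    simp only [Pi.neg_apply, mul_neg]
  · simp

theorem mem_vertex_pair_iff {n : ℕ} (hn : 1 ≤ n) {μ ν : Fin 4} (h : μ ≠ ν) (j : Fin 4 → ℤ) :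
    (j ∈ freqsHom n ∧ topSet n j = {μ, ν} ∧ botSet n j = {μ, ν}ᶜ) ↔
      j = fun x => if x = μ ∨ x = ν then 2 * (n : ℤ) else -2 * n := by
  obtain ⟨a, b, hab, haμ, haν, hbμ, hbν, hall⟩ := exists_other_indices h
  have hsum := fun f : Fin 4 → ℤ => sum_fin_four_eq h hab haμ haν hbμ hbν hall f
  constructor
  · rintro ⟨hj, h1, h2⟩
    have e : ∀ x y, (x = μ ∨ x = ν) → ¬ (y = μ ∨ y = ν) → j x - j y = 4 * n := by
      intro x y hx hy
      rw [sub_eq_iff hj, h1, h2]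
      exact ⟨by simpa using hx, by simpa using hy⟩
    have e1 := e μ a (by simp) (by simp [haμ, haν])
    have e2 := e ν a (by simp) (by simp [haμ, haν])
    have e3 := e ν b (by simp) (by simp [hbμ, hbν])
    obtain ⟨h0, -, -, -⟩ := (mem_freqsHom_iff n j).1 hj
    rw [hsum] at h0
    funext x
    rcases hall x with rfl | rfl | rfl | rfl <;> simp [haμ, haν, hbμ, hbν] <;> omega
  · rintro rfl
    have e : ∀ x y, (if x = μ ∨ x = ν then 2 * (n : ℤ) else -2 * n) -
        (if y = μ ∨ y = ν then 2 * (n : ℤ) else -2 * n) = 4 * n ↔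
          x ∈ ({μ, ν} : Finset (Fin 4)) ∧ y ∈ ({μ, ν} : Finset (Fin 4))ᶜ := by
      intro x y
      simp only [Finset.mem_insert, Finset.mem_singleton, Finset.mem_compl]
      by_cases hx : x = μ ∨ x = ν <;> by_cases hy : y = μ ∨ y = ν <;>
        simp only [hx, hy, if_true, if_false, not_true, not_false_iff, and_self, and_true,
          and_false, iff_true, iff_false] <;> omega
    refine ⟨(mem_freqsHom_iff n _).2 ⟨?_, ?_, ?_, ?_⟩, topSet_botSet_of_sub_iff ⟨μ, by simp⟩
      ⟨a, by simp [haμ, haν]⟩ e⟩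
    · rw [hsum]
      simp [haμ, haν, hbμ, hbν]
    · intro x y
      simp only [Int.ModEq]
      split_ifs <;> omega
    · intro x
      simp only [Int.ModEq]
      split_ifs <;> omega
    · intro x y
      split_ifs <;> omega

theorem elementSum_vertex_pair {n : ℕ} (hn : 1 ≤ n) {μ ν : Fin 4} (h : μ ≠ ν) {t : Fin 4 → ℝ}
    (ht : ∑ x, t x = 0) :
    elementSum n {μ, ν} {μ, ν}ᶜ t + elementSum n {μ, ν}ᶜ {μ, ν} t =
      ((2 * Real.cos (2 * π * n * (t μ + t ν)) : ℝ) : ℂ) := by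
  have key : ∀ t : Fin 4 → ℝ, ∑ x, t x = 0 → elementSum n {μ, ν} {μ, ν}ᶜ t =
      Complex.exp (((2 * π * n * (t μ + t ν) : ℝ) : ℂ) * Complex.I) := by
    intro t ht
    unfold elementSum
    rw [← Finset.sum_filter,
      Finset.sum_eq_single_of_mem _ (Finset.mem_filter.2 ((mem_vertex_pair_iff hn h _).2 rfl))]
    · unfold expoHom
      have h1 : ∑ x, (((if x = μ ∨ x = ν then 2 * (n : ℤ) else -2 * n : ℤ) : ℝ) * t x) =
          4 * n * (t μ + t ν) := by
        have h2 : ∀ x, (((if x = μ ∨ x = ν then 2 * (n : ℤ) else -2 * n : ℤ) : ℝ) * t x) =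
            -2 * n * t x + ((if x = μ then 4 * n * t x else 0) +
              if x = ν then 4 * n * t x else 0) := by
          intro x
          by_cases hμ : x = μ
          · simp [hμ, h]
            ring
          · by_cases hν : x = ν
            · simp [hν, h.symm]
              ring
            · simp [hμ, hν]
        simp only [h2, Finset.sum_add_distrib, ← Finset.mul_sum, ht]
        simp
        ring
      rw [h1]
      congr 1
      push_cast
      ring
    · intro j hj hne
      exact absurd ((mem_vertex_pair_iff hn h j).1 (Finset.mem_filter.1 hj)) hne
  rw [elementSum_swap n {μ, ν}, key t ht, key (-t) (by simp [ht]), ofReal_two_mul_cos]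
  congr 4
  simp only [Pi.neg_apply]
  ring

theorem kernelHom_eq {n : ℕ} (hn : 1 ≤ n) {t : Fin 4 → ℝ} (ht : ∑ x, t x = 0) :
    kernelHom n t = 1 / (2 * (n : ℂ) ^ 3) *
        (1 / 2 * (partialSum n t + partialSum (n - 1) t)
          + ((- (1 / 3) * (∑ ν : Fin 4, sinQuot ((n - 1) / 2) (2 * Real.pi * t ν) *
                ∑ j ∈ Finset.univ.erase ν,
                  Real.cos (2 * Real.pi * (n * t j + ((n / 2 : ℕ) : ℝ) * t ν)))
              + vertexCorrection n t : ℝ) : ℂ)) := by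
  rw [kernelHom, sum_weight_expoHom hn]
  have h1 : ∑ ν : Fin 4, ∑ i ∈ Finset.univ.erase ν,
      (elementSum n {i} {ν, i}ᶜ t + elementSum n {ν, i}ᶜ {i} t) =
      ((2 * ∑ ν : Fin 4, sinQuot ((n - 1) / 2) (2 * Real.pi * t ν) *
        ∑ j ∈ Finset.univ.erase ν,
          Real.cos (2 * Real.pi * (n * t j + ((n / 2 : ℕ) : ℝ) * t ν)) : ℝ) : ℂ) := by
    simp only [Finset.mul_sum, Complex.ofReal_sum]
    refine Finset.sum_congr rfl fun ν _ => Finset.sum_congr rfl fun i hi => ?_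
    exact elementSum_edge_add_swap hn (Finset.ne_of_mem_erase hi) ht
  have h2 : ∑ ν : Fin 4, ∑ μ ∈ Finset.univ.filter (fun μ => μ < ν),
      (elementSum n {μ, ν} {μ, ν}ᶜ t + elementSum n {μ, ν}ᶜ {μ, ν} t) =
      ((2 * ∑ ν : Fin 4, ∑ μ ∈ Finset.univ.filter (fun μ => μ < ν),
        Real.cos (2 * π * n * (t μ + t ν)) : ℝ) : ℂ) := by
    simp only [Finset.mul_sum, Complex.ofReal_sum]
    refine Finset.sum_congr rfl fun ν _ => Finset.sum_congr rfl fun μ hμ => ?_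
    exact elementSum_vertex_pair hn (Finset.mem_filter.1 hμ).2.ne ht
  have h3 : ∑ i : Fin 4, (elementSum n {i} {i}ᶜ t + elementSum n {i}ᶜ {i} t) =
      ((2 * (if Even n then ∑ i, Real.cos (2 * π * n * t i) else 0) : ℝ) : ℂ) := by
    simp only [elementSum_vertex hn _ ht]
    split_ifs
    · simp only [Finset.mul_sum, Complex.ofReal_sum]
    · simp
  rw [h1, h2, h3, vertexCorrection]
  congr 1
  generalize (∑ ν : Fin 4, sinQuot ((n - 1) / 2) (2 * Real.pi * t ν) * _) = A
  generalize (∑ ν : Fin 4, ∑ μ ∈ _, Real.cos _) = B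
  generalize (if Even n then _ else (0 : ℝ)) = C
  push_cast
  ring

/-! ### Partial sums as increments of an even part -/

/-- The exponential `exp (2πi s)`. -/
noncomputable def unitExp (s : ℝ) : ℂ := Complex.exp (2 * π * Complex.I * s)

theorem prod_unitExp {t : Fin 4 → ℝ} (ht : ∑ i, t i = 0) : ∏ i, unitExp (t i) = 1 := by
  have : (∑ i, (t i : ℂ)) = 0 := by exact_mod_cast ht
  simp only [unitExp]
  rw [← Complex.exp_sum, ← Finset.mul_sum, this, mul_zero, Complex.exp_zero]

/-- The sum of the monomials of even degree with exponents below `N`. -/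
noncomputable def evenSum (N : ℕ) (z : Fin 4 → ℂ) : ℂ :=
  ∑ p ∈ Fintype.piFinset (fun _ : Fin 4 => Finset.range N),
    if Even (∑ i, p i) then ∏ i, z i ^ p i else 0

/-- Lowering all four exponents by 1 keeps the parity of the degree and, by `hz`, the value of the
monomial; it is possible exactly when no exponent is 0. -/
theorem evenSum_succ (n : ℕ) {z : Fin 4 → ℂ} (hz : ∏ i, z i = 1) :
    evenSum (n + 1) z = (∑ p ∈ Fintype.piFinset (fun _ : Fin 4 => Finset.range (n + 1)),
      if Even (∑ i, p i) ∧ ∃ i, p i = 0 then ∏ i, z i ^ p i else 0) + evenSum n z := by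
  have h1 : evenSum n z = ∑ p ∈ Fintype.piFinset (fun _ : Fin 4 => Finset.range (n + 1)),
      if Even (∑ i, p i) ∧ ¬ ∃ i, p i = 0 then ∏ i, z i ^ p i else 0 := by
    unfold evenSum
    rw [← Finset.sum_filter, ← Finset.sum_filter]
    refine Finset.sum_bij' (fun p _ => fun i => p i + 1) (fun p _ => fun i => p i - 1)
      ?_ ?_ ?_ ?_ ?_
    · intro p hp
      simp only [Finset.mem_filter, Fintype.mem_piFinset, Finset.mem_range] at hp ⊢
      refine ⟨fun i => by have := hp.1 i; omega, ?_, ?_⟩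
      · rw [Finset.sum_add_distrib]
        exact hp.2.add (by simp; decide)
      · simp
    · intro p hp
      simp only [Finset.mem_filter, Fintype.mem_piFinset, Finset.mem_range] at hp ⊢
      obtain ⟨h1, h2, h3⟩ := hp
      push Not at h3
      refine ⟨fun i => by have := h1 i; have := h3 i; omega, ?_⟩
      rw [Fin.sum_univ_four, Nat.even_iff] at *
      have := h3 0
      have := h3 1
      have := h3 2
      have := h3 3
      omega
    · intro p _
      simp
    · intro p hp
      simp only [Finset.mem_filter] at hp
      obtain ⟨h1, h2, h3⟩ := hp
      push Not at h3
      funext i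
      have := h3 i
      change p i - 1 + 1 = p i
      omega
    · intro p _
      simp only [pow_succ, Finset.prod_mul_distrib, hz, mul_one]
  rw [h1, evenSum, ← Finset.sum_add_distrib]
  refine Finset.sum_congr rfl fun p _ => ?_
  by_cases h : Even (∑ i, p i) <;> by_cases h' : ∃ i, p i = 0 <;> simp only [h, h', and_self,
    if_true, if_false, not_true, not_false_iff, and_true, and_false, add_zero, zero_add]

theorem partialSum_eq_sum (n : ℕ) {t : Fin 4 → ℝ} (ht : ∑ i, t i = 0) :
    partialSum n t = ∑ p ∈ Fintype.piFinset (fun _ : Fin 4 => Finset.range (n + 1)),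
      if Even (∑ i, p i) ∧ ∃ i, p i = 0 then ∏ i, unitExp (t i) ^ p i else 0 := by
  unfold partialSum
  rw [← Finset.sum_filter]
  symm
  refine Finset.sum_bij (fun p _ => fun i => 4 * (p i : ℤ) - ∑ l, (p l : ℤ)) ?_ ?_ ?_ ?_
  · intro p hp
    simp only [Finset.mem_filter, Fintype.mem_piFinset, Finset.mem_range] at hp
    obtain ⟨h1, ⟨c, hc⟩, -⟩ := hp
    have hc' : ∑ l, (p l : ℤ) = c + c := by exact_mod_cast hc
    rw [mem_freqsHom_iff]
    refine ⟨?_, fun a b => ?_, fun a => ?_, fun a b => ?_⟩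
    · rw [Finset.sum_sub_distrib, ← Finset.mul_sum]
      simp
    · simp only [Int.ModEq]
      omega
    · simp only [hc', Int.ModEq]
      omega
    · have := h1 a
      have := h1 b
      omega
  -- The zero entry of `p` gives `∑ p ≤ ∑ q`, that of `q` the reverse; equal sums then give equal
  -- entries.
  · intro p hp q hq hpq
    simp only [Finset.mem_filter] at hp hq
    obtain ⟨-, -, i, hi⟩ := hp
    obtain ⟨-, -, l, hl⟩ := hq
    have e : ∀ x, 4 * (p x : ℤ) - ∑ l, (p l : ℤ) = 4 * (q x : ℤ) - ∑ l, (q l : ℤ) :=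
      fun x => congrFun hpq x
    have ei := e i
    have el := e l
    funext x
    have ex := e x
    omega
  · intro j hj
    have hle := sub_le_of_mem_freqsHom hj
    obtain ⟨h0, h4, h2, -⟩ := (mem_freqsHom_iff n j).1 hj
    -- The preimage is `p = (j - min j) / 4`, whose entries sum to `-min j` since `j` has sum 0.
    obtain ⟨m, -, hm⟩ := Finset.exists_min_image Finset.univ j ⟨0, Finset.mem_univ _⟩
    have hp : ∀ x, (((j x - j m) / 4).toNat : ℤ) * 4 = j x - j m := by
      intro x
      have h1 := hm x (Finset.mem_univ _)
      have h3 := h4 x m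
      simp only [Int.ModEq] at h3
      omega
    have hs : (∑ x, (((j x - j m) / 4).toNat : ℤ)) = - j m := by
      have h1 : (∑ x, (((j x - j m) / 4).toNat : ℤ)) * 4 = - j m * 4 := by
        rw [Finset.sum_mul, Finset.sum_congr rfl fun x _ => hp x, Finset.sum_sub_distrib, h0]
        simp
        ring
      omega
    refine ⟨fun x => ((j x - j m) / 4).toNat, ?_, ?_⟩
    · simp only [Finset.mem_filter, Fintype.mem_piFinset, Finset.mem_range]
      refine ⟨fun x => ?_, ?_, m, by simp⟩
      · have h1 := hle x m
        omega
      · have h1 := h2 m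
        simp only [Int.ModEq] at h1
        rw [← Int.even_coe_nat, Nat.cast_sum, hs, Int.even_iff]
        omega
    · funext x
      have := hp x
      simp only [hs]
      omega
  · intro p _
    unfold expoHom unitExp
    simp only [← Complex.exp_nat_mul]
    rw [← Complex.exp_sum]
    congr 1
    have h1 : ∑ i, ((4 * (p i : ℤ) - ∑ l, (p l : ℤ) : ℤ) : ℝ) * t i = 4 * ∑ i, p i * t i := by
      push_cast
      simp only [sub_mul, Finset.sum_sub_distrib, ← Finset.mul_sum, ht, mul_zero, sub_zero,
        mul_assoc]
    rw [h1]
    push_cast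
    simp only [Finset.mul_sum]
    refine Finset.sum_congr rfl fun i _ => ?_
    ring

theorem partialSum_eq_evenSum (n : ℕ) {t : Fin 4 → ℝ} (ht : ∑ i, t i = 0) :
    partialSum n t = evenSum (n + 1) (fun i => unitExp (t i)) - evenSum n fun i => unitExp (t i) := by
  rw [evenSum_succ n (prod_unitExp ht), partialSum_eq_sum n ht, add_sub_cancel_right]

/-- Replacing `z` by `-z` multiplies a monomial by the sign of its degree parity, so averaging keeps
the even ones. -/
theorem evenSum_eq (N : ℕ) (z : Fin 4 → ℂ) : evenSum N z =
    (∏ i, ∑ p ∈ Finset.range N, z i ^ p + ∏ i, ∑ p ∈ Finset.range N, (-z i) ^ p) / 2 := by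
  rw [Finset.prod_univ_sum, Finset.prod_univ_sum, ← Finset.sum_add_distrib, Finset.sum_div,
    evenSum]
  refine Finset.sum_congr rfl fun p _ => ?_
  have h1 : ∏ i, (-z i) ^ p i = (-1) ^ (∑ i, p i) * ∏ i, z i ^ p i := by
    rw [← Finset.prod_pow_eq_pow_sum, ← Finset.prod_mul_distrib]
    exact Finset.prod_congr rfl fun i _ => neg_pow _ _
  rw [h1]
  split_ifs with h
  · rw [h.neg_one_pow]
    ring
  · rw [(Nat.not_even_iff_odd.1 h).neg_one_pow]
    ring

/-! ### The odd part and its increments -/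

/-- Half the difference of the products of `a + b` and `a - b`: the products with an odd
number of factors `b`. -/
theorem prod_add_sub_prod_sub (a b : Fin 4 → ℂ) :
    (∏ i, (a i + b i) - ∏ i, (a i - b i)) / 2 =
      ∑ j, (b j * ∏ i ∈ Finset.univ.erase j, a i + a j * ∏ i ∈ Finset.univ.erase j, b i) := by
  have e0 : Finset.univ.erase (0 : Fin 4) = {1, 2, 3} := by decide
  have e1 : Finset.univ.erase (1 : Fin 4) = {0, 2, 3} := by decide
  have e2 : Finset.univ.erase (2 : Fin 4) = {0, 1, 3} := by decide
  have e3 : Finset.univ.erase (3 : Fin 4) = {0, 1, 2} := by decide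
  simp [Fin.prod_univ_four, Fin.sum_univ_four, e0, e1, e2, e3]
  ring

/-- The odd part of the product of the geometric sums of length `N`. -/
noncomputable def oddPart (N : ℕ) (z : Fin 4 → ℂ) : ℂ :=
  (∏ i, ∑ p ∈ Finset.range N, z i ^ p - ∏ i, ∑ p ∈ Finset.range N, (-z i) ^ p) / 2

/-- The quotient `sin (2πMs) / sin (2πs)`. -/
noncomputable def sinRatio (M : ℤ) (s : ℝ) : ℝ :=
  Real.sin (2 * π * M * s) / Real.sin (2 * π * s)

theorem sinRatio_add {s : ℝ} (hs : Real.sin (2 * π * s) ≠ 0) (M : ℤ) :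
    sinRatio (M + 1) s + sinRatio (M - 1) s = 2 * Real.cos (2 * π * s) * sinRatio M s := by
  unfold sinRatio
  have h1 : 2 * π * ((M + 1 : ℤ) : ℝ) * s = 2 * π * M * s + 2 * π * s := by push_cast; ring
  have h2 : 2 * π * ((M - 1 : ℤ) : ℝ) * s = 2 * π * M * s - 2 * π * s := by push_cast; ring
  rw [h1, h2, Real.sin_add, Real.sin_sub]
  field_simp
  ring

theorem unitExp_ne_zero (s : ℝ) : unitExp s ≠ 0 := Complex.exp_ne_zero _

theorem unitExp_eq (s : ℝ) :
    unitExp s = Real.cos (2 * π * s) + Real.sin (2 * π * s) * Complex.I := by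
  unfold unitExp
  rw [Complex.ofReal_cos, Complex.ofReal_sin, ← Complex.exp_mul_I]
  congr 1
  push_cast
  ring

theorem unitExp_add_inv (s : ℝ) : unitExp s + (unitExp s)⁻¹ = 2 * Real.cos (2 * π * s) := by
  rw [Complex.ofReal_cos, Complex.two_cos, unitExp, ← Complex.exp_neg]
  congr 2 <;> (push_cast; ring)

theorem unitExp_sub_inv (s : ℝ) :
    unitExp s - (unitExp s)⁻¹ = 2 * Real.sin (2 * π * s) * Complex.I := by
  have h : (unitExp s)⁻¹ = unitExp (-s) := by
    rw [unitExp, unitExp, ← Complex.exp_neg]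
    congr 1
    push_cast
    ring
  rw [h, unitExp_eq, unitExp_eq, mul_neg, Real.cos_neg, Real.sin_neg]
  push_cast
  ring

theorem mul_sum_range_sq_pow {s : ℝ} (hs : Real.sin (2 * π * s) ≠ 0) (M : ℕ) :
    unitExp s * ∑ a ∈ Finset.range M, unitExp s ^ (2 * a) = unitExp s ^ M * sinRatio M s := by
  have hz := unitExp_ne_zero s
  have hs' : (Real.sin (2 * π * s) : ℂ) ≠ 0 := by exact_mod_cast hs
  have h1 := unitExp_sub_inv s
  have h2 := unitExp_sub_inv (M * s)
  have hM : unitExp (M * s) = unitExp s ^ M := by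
    unfold unitExp
    rw [← Complex.exp_nat_mul]
    congr 1
    push_cast
    ring
  have h3 : 2 * π * (M * s) = 2 * π * ((M : ℤ) : ℝ) * s := by push_cast; ring
  rw [hM, h3] at h2
  have h4 : unitExp s - (unitExp s)⁻¹ ≠ 0 := by
    rw [h1]
    exact mul_ne_zero (mul_ne_zero two_ne_zero hs') Complex.I_ne_zero
  have h5 : (sinRatio M s : ℂ) = (unitExp s ^ M - (unitExp s ^ M)⁻¹) /
      (unitExp s - (unitExp s)⁻¹) := by
    rw [h1, h2, sinRatio, Complex.ofReal_div, mul_div_mul_right _ _ Complex.I_ne_zero,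
      mul_div_mul_left _ _ two_ne_zero]
  have h6 := geom_sum_mul (unitExp s ^ 2) M
  simp only [← pow_mul] at h6
  rw [h5, ← mul_div_assoc, eq_div_iff h4]
  have h7 : unitExp s ^ M * (unitExp s ^ M)⁻¹ = 1 := mul_inv_cancel₀ (pow_ne_zero _ hz)
  have h8 : unitExp s * (unitExp s)⁻¹ = 1 := mul_inv_cancel₀ hz
  have h9 : unitExp s ^ (2 * M) = unitExp s ^ M * unitExp s ^ M := by rw [two_mul, pow_add]
  linear_combination h6 + h9 + h7 - (∑ a ∈ Finset.range M, unitExp s ^ (2 * a)) * h8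

theorem sum_range_two_mul (y : ℂ) (M : ℕ) : ∑ p ∈ Finset.range (2 * M), y ^ p =
    ∑ a ∈ Finset.range M, y ^ (2 * a) + y * ∑ a ∈ Finset.range M, y ^ (2 * a) := by
  induction M with
  | zero => simp
  | succ M ih =>
    rw [mul_add, mul_one, Finset.sum_range_succ, Finset.sum_range_succ, ih,
      Finset.sum_range_succ _ M]
    ring

theorem sum_range_neg_two_mul (y : ℂ) (M : ℕ) : ∑ p ∈ Finset.range (2 * M), (-y) ^ p =
    ∑ a ∈ Finset.range M, y ^ (2 * a) - y * ∑ a ∈ Finset.range M, y ^ (2 * a) := by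
  rw [sum_range_two_mul]
  simp only [(even_two_mul _).neg_pow]
  ring

/-- Split each geometric sum into even and odd powers, `z^M r / z` and `z^M r` with `r` the sine
ratio. The factors `z^M` multiply to 1; the choices of one and of three odd factors contribute `z_j`
and `z_j⁻¹`, which add up to the cosine. -/
theorem oddPart_two_mul {t : Fin 4 → ℝ} (ht : ∑ i, t i = 0)
    (hs : ∀ i, Real.sin (2 * π * t i) ≠ 0) (M : ℕ) :
    oddPart (2 * M) (fun i => unitExp (t i)) =
      ∑ j, 2 * Real.cos (2 * π * t j) * sinRatio M (t j) *
        ∏ i ∈ Finset.univ.erase j, (sinRatio M (t i) : ℂ) := by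
  have hz : ∏ i, unitExp (t i) ^ M = 1 := by rw [Finset.prod_pow, prod_unitExp ht, one_pow]
  have he : ∀ i, ∑ a ∈ Finset.range M, unitExp (t i) ^ (2 * a) =
      unitExp (t i) ^ M * (sinRatio M (t i) / unitExp (t i)) := by
    intro i
    have := unitExp_ne_zero (t i)
    rw [← mul_div_assoc, eq_div_iff this, mul_comm, mul_sum_range_sq_pow (hs i)]
  have h1 : ∀ i, ∑ p ∈ Finset.range (2 * M), unitExp (t i) ^ p =
      unitExp (t i) ^ M * (sinRatio M (t i) / unitExp (t i) + sinRatio M (t i)) := by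
    intro i
    rw [sum_range_two_mul, mul_sum_range_sq_pow (hs i), he, mul_add]
  have h2 : ∀ i, ∑ p ∈ Finset.range (2 * M), (-unitExp (t i)) ^ p =
      unitExp (t i) ^ M * (sinRatio M (t i) / unitExp (t i) - sinRatio M (t i)) := by
    intro i
    rw [sum_range_neg_two_mul, mul_sum_range_sq_pow (hs i), he, mul_sub]
  unfold oddPart
  simp only [h1, h2, Finset.prod_mul_distrib, hz, one_mul]
  rw [prod_add_sub_prod_sub]
  refine Finset.sum_congr rfl fun j _ => ?_
  have h3 : ∏ i ∈ Finset.univ.erase j, unitExp (t i) = (unitExp (t j))⁻¹ := by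
    refine eq_inv_of_mul_eq_one_left ?_
    rw [Finset.prod_erase_mul _ _ (Finset.mem_univ j), prod_unitExp ht]
  rw [Finset.prod_div_distrib, h3, div_inv_eq_mul, ← unitExp_add_inv]
  ring

/-- For odd length the even powers outnumber the odd ones by one, so after removing `z^M` the two
halves are the ratios of index `M + 1` and `M`, with no leftover power of `z`. -/
theorem oddPart_two_mul_add_one {t : Fin 4 → ℝ} (ht : ∑ i, t i = 0)
    (hs : ∀ i, Real.sin (2 * π * t i) ≠ 0) (M : ℕ) :
    oddPart (2 * M + 1) (fun i => unitExp (t i)) =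
      ∑ j, ((sinRatio M (t j) : ℂ) * ∏ i ∈ Finset.univ.erase j, (sinRatio (M + 1) (t i) : ℂ) +
        sinRatio (M + 1) (t j) * ∏ i ∈ Finset.univ.erase j, (sinRatio M (t i) : ℂ)) := by
  have hz : ∏ i, unitExp (t i) ^ M = 1 := by rw [Finset.prod_pow, prod_unitExp ht, one_pow]
  have he : ∀ i, ∑ a ∈ Finset.range (M + 1), unitExp (t i) ^ (2 * a) =
      unitExp (t i) ^ M * sinRatio (M + 1) (t i) := by
    intro i
    refine mul_left_cancel₀ (unitExp_ne_zero (t i)) ?_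
    rw [mul_sum_range_sq_pow (hs i), pow_succ]
    push_cast
    ring
  have h1 : ∀ i, ∑ p ∈ Finset.range (2 * M + 1), unitExp (t i) ^ p =
      unitExp (t i) ^ M * (sinRatio (M + 1) (t i) + sinRatio M (t i)) := by
    intro i
    rw [Finset.sum_range_succ, sum_range_two_mul, mul_sum_range_sq_pow (hs i), mul_add, ← he,
      Finset.sum_range_succ]
    ring
  have h2 : ∀ i, ∑ p ∈ Finset.range (2 * M + 1), (-unitExp (t i)) ^ p =
      unitExp (t i) ^ M * (sinRatio (M + 1) (t i) - sinRatio M (t i)) := by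
    intro i
    rw [Finset.sum_range_succ, sum_range_neg_two_mul, mul_sum_range_sq_pow (hs i), mul_sub, ← he,
      Finset.sum_range_succ, (even_two_mul M).neg_pow]
    ring
  unfold oddPart
  simp only [h1, h2, Finset.prod_mul_distrib, hz, one_mul]
  rw [prod_add_sub_prod_sub]

theorem thetaOdd_even (M : ℤ) (x : Fin 3 → ℝ) : thetaOdd (2 * M) x =
    ∑ j, sinRatio M (toHom x j) * ∏ i ∈ Finset.univ.erase j, sinRatio (M + 1) (toHom x i) := by
  rw [thetaOdd, if_pos (even_two_mul M)]
  have h1 : ∀ s : ℝ, ((2 * M : ℤ) : ℝ) * π * s = 2 * π * M * s := by intro s; push_cast; ring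
  have h2 : ∀ s : ℝ, (((2 * M : ℤ) : ℝ) + 2) * π * s = 2 * π * ((M + 1 : ℤ) : ℝ) * s := by
    intro s; push_cast; ring
  simp only [h1, h2, sinRatio]

theorem thetaOdd_odd (M : ℤ) (x : Fin 3 → ℝ) : thetaOdd (2 * M + 1) x =
    ∑ j, sinRatio (M + 2) (toHom x j) *
      ∏ i ∈ Finset.univ.erase j, sinRatio (M + 1) (toHom x i) := by
  rw [thetaOdd, if_neg (Int.not_even_iff_odd.2 (odd_two_mul_add_one M))]
  have h1 : ∀ s : ℝ, (((2 * M + 1 : ℤ) : ℝ) + 3) * π * s = 2 * π * ((M + 2 : ℤ) : ℝ) * s := by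
    intro s; push_cast; ring
  have h2 : ∀ s : ℝ, (((2 * M + 1 : ℤ) : ℝ) + 1) * π * s = 2 * π * ((M + 1 : ℤ) : ℝ) * s := by
    intro s; push_cast; ring
  simp only [h1, h2, sinRatio]

/-- The recurrence `sinRatio_add` absorbs the cosine in the even-length formula. What remains has
the shape of `thetaOdd` at `n` and `n - 2`, and the parity of `n` decides which of its two forms
occurs. -/
theorem oddPart_sub {x : Fin 3 → ℝ} (hs : ∀ i, Real.sin (2 * π * toHom x i) ≠ 0) (n : ℕ) :
    oddPart (n + 1) (fun i => unitExp (toHom x i)) - oddPart n (fun i => unitExp (toHom x i)) =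
      ((thetaOdd n x - thetaOdd (n - 2) x : ℝ) : ℂ) := by
  have ht := sum_toHom x
  obtain ⟨M, rfl | rfl⟩ := Nat.even_or_odd' n
  · rw [oddPart_two_mul ht hs, oddPart_two_mul_add_one ht hs]
    have h1 : ((2 * M : ℕ) : ℤ) = 2 * (M : ℤ) := by push_cast; ring
    have h2 : 2 * (M : ℤ) - 2 = 2 * ((M : ℤ) - 1) := by ring
    rw [h1, h2, thetaOdd_even, thetaOdd_even]
    push_cast
    rw [← Finset.sum_sub_distrib, ← Finset.sum_sub_distrib]
    refine Finset.sum_congr rfl fun j _ => ?_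
    have h3 := congrArg (fun r : ℝ => (r : ℂ)) (sinRatio_add (hs j) M)
    push_cast at h3
    simp only [sub_add_cancel]
    linear_combination (∏ i ∈ Finset.univ.erase j, (sinRatio M (toHom x i) : ℂ)) * h3
  · have h0 : 2 * M + 1 + 1 = 2 * (M + 1) := by ring
    rw [h0, oddPart_two_mul ht hs, oddPart_two_mul_add_one ht hs]
    have h1 : ((2 * M + 1 : ℕ) : ℤ) = 2 * (M : ℤ) + 1 := by push_cast; ring
    have h2 : 2 * (M : ℤ) + 1 - 2 = 2 * ((M : ℤ) - 1) + 1 := by ring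
    rw [h1, h2, thetaOdd_odd, thetaOdd_odd]
    push_cast
    rw [← Finset.sum_sub_distrib, ← Finset.sum_sub_distrib]
    refine Finset.sum_congr rfl fun j _ => ?_
    have h3 := congrArg (fun r : ℝ => (r : ℂ)) (sinRatio_add (hs j) (M + 1))
    have h4 : (M : ℤ) + 1 + 1 = M + 2 := by ring
    have h5 : (M : ℤ) - 1 + 2 = M + 1 := by ring
    rw [h4] at h3
    push_cast at h3
    simp only [sub_add_cancel, add_sub_cancel_right, h5] at h3 ⊢
    linear_combination -(∏ i ∈ Finset.univ.erase j, (sinRatio (M + 1) (toHom x i) : ℂ)) * h3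

/-! ### The full product and the closed form of the partial sums -/

theorem cos_sq_add_eq (a b c : ℝ) :
    Real.cos (b + c) ^ 2 + Real.cos (a + c) ^ 2 + Real.cos (a + b) ^ 2
      - 2 * Real.cos (b + c) * Real.cos (a + c) * Real.cos (a + b) - 1 =
    -4 * (Real.sin a * Real.sin b * Real.sin c * Real.sin (a + b + c)) := by
  have ha := Real.sin_sq_add_cos_sq a
  have hb := Real.sin_sq_add_cos_sq b
  have hc := Real.sin_sq_add_cos_sq c
  simp only [Real.cos_add, Real.sin_add]
  grind

theorem mul_sum_range_pow {s : ℝ} (hs : Real.sin (π * s) ≠ 0) (N : ℕ) :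
    unitExp (s / 2) * ∑ p ∈ Finset.range N, unitExp s ^ p =
      unitExp (s / 2) ^ N * ((Real.sin (N * π * s) / Real.sin (π * s) : ℝ) : ℂ) := by
  have h1 : unitExp s = unitExp (s / 2) ^ 2 := by
    unfold unitExp
    rw [← Complex.exp_nat_mul]
    congr 1
    push_cast
    ring
  have h2 := mul_sum_range_sq_pow (s := s / 2) (by convert hs using 2; ring) N
  simp only [pow_mul, ← h1] at h2
  rw [h2, sinRatio]
  congr 4 <;> (push_cast; ring)

/-- Each geometric sum is a half-angle power times `sin (Nπt) / sin (πt)`, and the half-angle powers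
multiply to 1. By `cos_sq_add_eq` and `t₄ = -(t₁ + t₂ + t₃)`, the numerator and denominator of
`theta` are 4 times the products of these sines. -/
theorem prod_sum_range_eq_theta {x : Fin 3 → ℝ} (hs : ∀ i, Real.sin (π * toHom x i) ≠ 0)
    (N : ℕ) : ∏ i, ∑ p ∈ Finset.range N, unitExp (toHom x i) ^ p = (theta N x : ℂ) := by
  have hz : ∏ i, unitExp (toHom x i / 2) = 1 := by
    refine prod_unitExp (t := fun i => toHom x i / 2) ?_
    rw [← Finset.sum_div, sum_toHom, zero_div]
  have h1 : ∏ i, ∑ p ∈ Finset.range N, unitExp (toHom x i) ^ p =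
      ((∏ i, (Real.sin (N * π * toHom x i) / Real.sin (π * toHom x i)) : ℝ) : ℂ) := by
    rw [← one_mul (∏ i, ∑ p ∈ Finset.range N, unitExp (toHom x i) ^ p), ← hz,
      ← Finset.prod_mul_distrib, Finset.prod_congr rfl fun i _ => mul_sum_range_pow (hs i) N,
      Finset.prod_mul_distrib, Finset.prod_pow, hz, one_pow, one_mul, Complex.ofReal_prod]
  have h2 : ∀ m : ℝ, Real.cos (m * x 0) ^ 2 + Real.cos (m * x 1) ^ 2 + Real.cos (m * x 2) ^ 2
      - 2 * Real.cos (m * x 0) * Real.cos (m * x 1) * Real.cos (m * x 2) - 1 =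
      4 * ∏ i, Real.sin (m * toHom x i) := by
    intro m
    have h3 := cos_sq_add_eq (m * toHom x 0) (m * toHom x 1) (m * toHom x 2)
    have e0 : m * toHom x 1 + m * toHom x 2 = m * x 0 := by simp [toHom]; ring
    have e1 : m * toHom x 0 + m * toHom x 2 = m * x 1 := by simp [toHom]; ring
    have e2 : m * toHom x 0 + m * toHom x 1 = m * x 2 := by simp [toHom]; ring
    have e3 : m * toHom x 0 + m * toHom x 1 + m * toHom x 2 = -(m * toHom x 3) := by
      simp [toHom]; ring
    rw [e3, e2, e1, e0, Real.sin_neg] at h3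
    rw [h3, Fin.prod_univ_four]
    ring
  rw [h1, theta]
  simp only [Int.cast_natCast]
  rw [h2, h2, mul_div_mul_left _ _ four_ne_zero, Finset.prod_div_distrib]

theorem partialSum_toHom_eq {x : Fin 3 → ℝ} (hs : ∀ i, Real.sin (2 * π * toHom x i) ≠ 0) (n : ℕ) :
    partialSum n (toHom x) = (partialSumClosed n x : ℂ) := by
  have hs' : ∀ i, Real.sin (π * toHom x i) ≠ 0 := by
    intro i h
    apply hs i
    rw [mul_assoc, Real.sin_two_mul, h]
    ring
  have h1 : ∀ N, evenSum N (fun i => unitExp (toHom x i)) =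
      theta N x - oddPart N (fun i => unitExp (toHom x i)) := by
    intro N
    rw [evenSum_eq, oddPart, ← prod_sum_range_eq_theta hs']
    ring
  rw [partialSum_eq_evenSum n (sum_toHom x), h1, h1, partialSumClosed, Complex.ofReal_sub,
    ← oddPart_sub hs]
  push_cast
  ring

end RD

/-! ### Assembly -/

theorem mainTheorem2 (n : ℕ) (hn : 1 ≤ n) :
    (∀ f : (Fin 3 → ℝ) → ℂ, ∀ j ∈ RD.nodes n,
      (j ∈ RD.interiorNodes n → RD.interp n f (RD.pt n j) = f (RD.pt n j)) ∧
      (j ∉ RD.interiorNodes n →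
        RD.interp n f (RD.pt n j) = ∑ k ∈ RD.congrNodes n j, f (RD.pt n k))) ∧
    (∀ x : Fin 3 → ℝ, (RD.kernel n x).im = 0) ∧
    (∀ x : Fin 3 → ℝ, RD.kernel n x = RD.kernelHom n (RD.toHom x)) ∧
    (∀ t : Fin 4 → ℝ, ∑ i, t i = 0 →
      RD.kernel n (RD.ofHom t) = RD.kernelHom n t ∧
      RD.kernelHom n t = 1 / (2 * (n : ℂ) ^ 3) *
        (1 / 2 * (RD.partialSum n t + RD.partialSum (n - 1) t)
          + ((- (1 / 3) * (∑ ν : Fin 4, RD.sinQuot ((n - 1) / 2) (2 * Real.pi * t ν) *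
                ∑ j ∈ Finset.univ.erase ν,
                  Real.cos (2 * Real.pi * (n * t j + ((n / 2 : ℕ) : ℝ) * t ν)))
              + RD.vertexCorrection n t : ℝ) : ℂ))) ∧
    (∀ x : Fin 3 → ℝ, (∀ ν, Real.sin (2 * Real.pi * RD.toHom x ν) ≠ 0) →
      RD.kernel n x = ((1 / (2 * (n : ℝ) ^ 3) *
        (1 / 2 * (RD.partialSumClosed n x + RD.partialSumClosed ((n : ℤ) - 1) x)
          - 1 / 3 * (∑ ν : Fin 4,
              Real.sin (2 * Real.pi * (((n - 1) / 2 : ℕ) : ℝ) * RD.toHom x ν) /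
                Real.sin (2 * Real.pi * RD.toHom x ν) *
              ∑ j ∈ Finset.univ.erase ν,
                Real.cos (2 * Real.pi * (n * RD.toHom x j + ((n / 2 : ℕ) : ℝ) * RD.toHom x ν)))
          + RD.vertexCorrection n (RD.toHom x)) : ℝ) : ℂ)) := by
  refine ⟨fun f j hj => ⟨fun hi => ?_, fun _ => RD.interp_pt hn f hj⟩, fun x => ?_,
    RD.kernel_eq_kernelHom n, fun t ht => ⟨?_, RD.kernelHom_eq hn ht⟩, fun x hs => ?_⟩
  · rw [RD.interp_pt hn f hj, RD.congrNodes_eq_singleton hn hi, Finset.sum_singleton]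
  -- Reality of the kernel is read off from its compact formula, in which only the partial sums are
  -- not visibly real.
  · have h : ∀ m t, RD.partialSum m t = ((RD.partialSum m t).re : ℂ) := fun m t =>
      Complex.ext rfl (by rw [RD.partialSum_im, Complex.ofReal_im])
    have h3 : (1 / (2 * (n : ℂ) ^ 3)) = ((1 / (2 * (n : ℝ) ^ 3) : ℝ) : ℂ) := by push_cast; rfl
    have h4 : (1 / 2 : ℂ) = ((1 / 2 : ℝ) : ℂ) := by push_cast; rfl
    rw [RD.kernel_eq_kernelHom, RD.kernelHom_eq hn (RD.sum_toHom x), h n, h (n - 1), h3, h4,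
      ← Complex.ofReal_add, ← Complex.ofReal_mul, ← Complex.ofReal_add, ← Complex.ofReal_mul,
      Complex.ofReal_im]
  · rw [RD.kernel_eq_kernelHom, RD.toHom_ofHom ht]
  · have hc : ((n - 1 : ℕ) : ℤ) = (n : ℤ) - 1 := by omega
    have hq : ∀ ν, RD.sinQuot ((n - 1) / 2) (2 * Real.pi * RD.toHom x ν) =
        Real.sin (2 * Real.pi * (((n - 1) / 2 : ℕ) : ℝ) * RD.toHom x ν) /
          Real.sin (2 * Real.pi * RD.toHom x ν) := by
      intro ν
      rw [RD.sinQuot, if_neg (hs ν)]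
      congr 2
      ring
    rw [RD.kernel_eq_kernelHom, RD.kernelHom_eq hn (RD.sum_toHom x), RD.partialSum_toHom_eq hs,
      RD.partialSum_toHom_eq hs, hc]
    simp only [hq]
    generalize (∑ ν : Fin 4, _ / _ * _ : ℝ) = A
    push_cast
    ring
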